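/- Let $n_1,n_2,r\ge 1$ and let $Y=L^*+S^*\in\mathbb{R}^{n_1\times n_2}$, where: - each row of $S^*$ has at most $\gamma^* n_2$ and each column at most $\gamma^* n_1$ nonzero entries, for some $\gamma^*\in[0,1)$; - $L^*$ has rank $r$ and is $\mu$-incoherent: in a compact singular value decomposition $L^*=U^*\Sigma^*V^{*T}$ with $U^*\in\mathbb{R}^{n_1\times r}$, $V^*\in\mathbb{R}^{n_2\times r}$, one has $\|U^*\|_{2,\infty}\le\sqrt{\mu r/n_1}$ and $\|V^*\|_{2,\infty}\le\sqrt{\mu r/n_2}$, where $\|A\|_{2,\infty}=\max_{\|z\|_2=1}\|Az\|_\infty$. Let $\mathcal M$ be the manifold of real $n_1\times n_2$ matrices of rank $r$, with tangent space $T_X\mathcal M=\{AX+XB: A\in\mathbb{R}^{n_1\times n_1},B\in\mathbb{R}^{n_2\times n_2}\}$ at $X\in\mathcal M$, and let $P_{T_X}$ be the orthogonal projection to $T_X\mathcal M$ for the Frobenius inner product. For $\gamma>0$ let $F(A)$ be the matrix obtained from $A$ by replacing with $0$ every entry that is among the largest $\gamma$-fraction, in absolute value, both of its row and of its column. Here the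 largest $\gamma$-fraction of $v\in\mathbb{R}^n$ is a set of at most $\gamma n$ entries that, for some $t$ with $\#\{j:|v_j|>t\}\le\gamma n\le\#\{j:|v_j|\ge t\}$, contains all entries with $|v_j|>t$ and none with $|v_j|<t$; ties are broken arbitrarily. For a starting point $L^{(0)}\in\mathcal M$ and a step size $\eta>0$, Riemannian gradient descent is the iteration $$L^{(k+1)}=R_{L^{(k)}}\big(-\eta\,P_{T_{L^{(k)}}}F(L^{(k)}-Y)\big),$$ where $R$ is one of the following two retractions: the projective retraction, for which $R_X(\delta)$ is a minimizer of $\|X+\delta-Z\|_F$ over $Z\in\mathcal M$, or the orthographic retraction, for which $R_X(\delta)$ is a minimizer of $\|X+\delta-Z\|_F$ over those $Z\in\mathcal M$ for which $Z-X-\delta$ is orthogonal to $T_X\mathcal M$. Suppose that $\|L^{(0)}-L^*\|_F\le a\,\sigma_r(L^*)$, where $\sigma_r(L^*)$ is the $r$-th largest singular value of $L^*$, that $a\le\tfrac12$ and $\gamma>2\gamma^*$, and that $$C_1=\sqrt{4(\gamma+2\gamma^*)\mu r+4\,\frac{\gamma^*}{\gamma-\gamma^*}+a^2}<\tfrac12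 .$$ Then there is $\eta_0>0$ such that for all step sizes $0<\eta<\eta_0$ and for each of the two retractions, however ties and the choice of minimizers are resolved, the iteration is well defined (the minimum that defines $L^{(k+1)}$ is attained at every step) and, for all $k\ge 0$, $$\|L^{(k)}-L^*\|_F\le\Big(1-\frac{1-2C_1}{8}\,\eta\Big)^k\|L^{(0)}-L^*\|_F .$$ -/

import Mathlib

/- Norms of matrices are Frobenius norms throughout. -/
open scoped Matrix.Norms.Frobenius

namespace RobustPCA

/-- Real `n₁ × n₂` matrices. -/
abbrev Mat (n₁ n₂ : ℕ) : Type := Matrix (Fin n₁) (Fin n₂) ℝ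

/-- The Frobenius inner product. -/
def frobInner {n₁ n₂ : ℕ} (A B : Mat n₁ n₂) : ℝ :=
  ∑ i, ∑ j, A i j * B i j

/-! ### Assumptions on the sparse and on the low-rank part -/

/-- Each row of `S` has at most `γs * n₂` nonzero entries, and each column at most `γs * n₁`. -/
def IsSparse {n₁ n₂ : ℕ} (γs : ℝ) (S : Mat n₁ n₂) : Prop :=
  (∀ i, ((Finset.univ.filter fun j => S i j ≠ 0).card : ℝ) ≤ γs * n₂) ∧
    ∀ j, ((Finset.univ.filter fun i => S i j ≠ 0).card : ℝ) ≤ γs * n₁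

/-- `L = U * diag s * Vᵀ` is a compact singular value decomposition with `r` singular values. -/
structure IsSVD {n₁ n₂ r : ℕ} (L : Mat n₁ n₂) (U : Mat n₁ r) (s : Fin r → ℝ) (V : Mat n₂ r) :
    Prop where
  left_orthonormal : U.transpose * U = 1
  right_orthonormal : V.transpose * V = 1
  pos : ∀ k, 0 < s k
  antitone : Antitone s
  eq : L = U * Matrix.diagonal s * V.transpose

/-- `‖A‖_{2,∞} ≤ c`, where `‖A‖_{2,∞}` is the maximum of `‖A z‖_∞` over the vectors `z` of
Euclidean norm `1`. -/
def TwoInftyNormLE {n r : ℕ} (A : Mat n r) (c : ℝ) : Prop :=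
  ∀ z : EuclideanSpace ℝ (Fin r), ‖z‖ = 1 → ∀ i, |A.mulVec z.ofLp i| ≤ c

/-- `L` has a compact SVD of size `r` whose factors are `μ`-incoherent. (The condition does not
depend on the choice of the SVD.) -/
def IsIncoherent {n₁ n₂ : ℕ} (μ : ℝ) (r : ℕ) (L : Mat n₁ n₂) : Prop :=
  ∃ (U : Mat n₁ r) (s : Fin r → ℝ) (V : Mat n₂ r), IsSVD L U s V ∧
    TwoInftyNormLE U (Real.sqrt (μ * r / n₁)) ∧ TwoInftyNormLE V (Real.sqrt (μ * r / n₂))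

/-- The `r`-th largest singular value, `r ≥ 1` (Mathlib numbers the singular values from `0`). -/
noncomputable def singularValue {n₁ n₂ : ℕ} (r : ℕ) (L : Mat n₁ n₂) : ℝ :=
  (Matrix.toEuclideanLin L).singularValues (r - 1)

/-! ### Hard thresholding -/

/-- `t` is a threshold for the largest `γ`-fraction of the absolute values of the entries of `v`:
at most `γ n` of them exceed `t`, and at least `γ n` of them are `≥ t`. -/
def IsPercentile {n : ℕ} (γ : ℝ) (v : Fin n → ℝ) (t : ℝ) : Prop :=
  ((Finset.univ.filter fun j => t < |v j|).card : ℝ) ≤ γ * n ∧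
    γ * n ≤ ((Finset.univ.filter fun j => t ≤ |v j|).card : ℝ)

/-- `T` is a set of positions of the largest `γ`-fraction of the entries of `v` in absolute value:
all entries above the percentile belong to it, none of those below, and ties at the percentile are
broken arbitrarily, as long as `T` has at most `γ n` elements. -/
def IsTopFraction {n : ℕ} (γ : ℝ) (v : Fin n → ℝ) (T : Finset (Fin n)) : Prop :=
  (T.card : ℝ) ≤ γ * n ∧
    ∃ t, IsPercentile γ v t ∧ (∀ j, t < |v j| → j ∈ T) ∧ ∀ j ∈ T, t ≤ |v j|

/-- `G` is a value of the hard thresholding operator `F` at `A`: the entries that are among the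
largest `γ`-fraction both of their row and of their column are replaced by `0`, and the others are
kept. (It is a relation because of the freedom in breaking ties.) -/
def IsHardThreshold {n₁ n₂ : ℕ} (γ : ℝ) (A G : Mat n₁ n₂) : Prop :=
  ∃ (T : Fin n₁ → Finset (Fin n₂)) (T' : Fin n₂ → Finset (Fin n₁)),
    (∀ i, IsTopFraction γ (fun j => A i j) (T i)) ∧
    (∀ j, IsTopFraction γ (fun i => A i j) (T' j)) ∧
    ∀ i j, G i j = if j ∈ T i ∧ i ∈ T' j then 0 else A i j

/-! ### Geometry of the manifold of matrices of rank `r` -/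

/-- The tangent space at `X` of the manifold of matrices of the same rank as `X`. -/
def tangentSpace {n₁ n₂ : ℕ} (X : Mat n₁ n₂) : Set (Mat n₁ n₂) :=
  {W | ∃ (A : Mat n₁ n₁) (B : Mat n₂ n₂), W = A * X + X * B}

/-- `P` is the orthogonal projection of `G` to the tangent space at `X`. -/
def IsTangentProjection {n₁ n₂ : ℕ} (X G P : Mat n₁ n₂) : Prop :=
  P ∈ tangentSpace X ∧ ∀ W ∈ tangentSpace X, frobInner (G - P) W = 0

/-- `Z` is the projective retraction of `δ` at `X`: a matrix of rank `r` nearest to `X + δ`. -/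
def IsProjectiveRetraction {n₁ n₂ : ℕ} (r : ℕ) (X δ Z : Mat n₁ n₂) : Prop :=
  Z.rank = r ∧ ∀ Z' : Mat n₁ n₂, Z'.rank = r → ‖X + δ - Z‖ ≤ ‖X + δ - Z'‖

/-- `Z` is admissible for the orthographic retraction of `δ` at `X`: it has rank `r`, and
`Z - (X + δ)` is orthogonal to the tangent space at `X`. -/
def IsOrthographicAdmissible {n₁ n₂ : ℕ} (r : ℕ) (X δ Z : Mat n₁ n₂) : Prop :=
  Z.rank = r ∧ ∀ W ∈ tangentSpace X, frobInner (Z - X - δ) W = 0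

/-- `Z` is the orthographic retraction of `δ` at `X`: an admissible matrix nearest to `X + δ`. -/
def IsOrthographicRetraction {n₁ n₂ : ℕ} (r : ℕ) (X δ Z : Mat n₁ n₂) : Prop :=
  IsOrthographicAdmissible r X δ Z ∧
    ∀ Z' : Mat n₁ n₂, IsOrthographicAdmissible r X δ Z' → ‖X + δ - Z‖ ≤ ‖X + δ - Z'‖

/-! ### Riemannian gradient descent -/

/-- `X'` arises from `X` by a step of size `η` against the Riemannian gradient, the projection of
the Euclidean gradient `G` to the tangent space, followed by the retraction `R`. -/
def IsUpdate {n₁ n₂ : ℕ} (R : Mat n₁ n₂ → Mat n₁ n₂ → Mat n₁ n₂ → Prop) (η : ℝ)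
    (X G X' : Mat n₁ n₂) : Prop :=
  ∃ P, IsTangentProjection X G P ∧ R X (-(η • P)) X'

/-- One iteration of gradient descent for the observation `Y`: the Euclidean gradient at `X` is the
hard thresholding of `X - Y` at level `γ`. -/
def IsStep {n₁ n₂ : ℕ} (R : Mat n₁ n₂ → Mat n₁ n₂ → Mat n₁ n₂ → Prop) (γ η : ℝ)
    (Y X X' : Mat n₁ n₂) : Prop :=
  ∃ G, IsHardThreshold γ (X - Y) G ∧ IsUpdate R η X G X'

/-- Gradient descent can be continued from `X`: the gradient has a value, and, for each of its
values (that is, however ties are broken), so does the next iterate. -/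
def CanContinue {n₁ n₂ : ℕ} (R : Mat n₁ n₂ → Mat n₁ n₂ → Mat n₁ n₂ → Prop) (γ η : ℝ)
    (Y X : Mat n₁ n₂) : Prop :=
  (∃ G, IsHardThreshold γ (X - Y) G) ∧
    ∀ G, IsHardThreshold γ (X - Y) G → ∃ X', IsUpdate R η X G X'

end RobustPCA

/- Two facts drive the proof. First, the rank-`r` manifold is tangent to second order to its tangent
spaces: if `Z` and `X` have rank `r`, the normal component of `Z - X` at `X` is at most
`‖Z - X‖ ^ 2 / (2 σ_r(X))`. Second, the entries of an incoherent tangent vector are spread out, so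
that hard thresholding, which alters only few entries per row and column, moves the residual
`X - Y` to within `C₁ ‖X - L*‖` of `X - L*`. Hence for `C₁ < 1/2` the Riemannian gradient has a
component of definite size along the error `X - L*`. Both retractions pick a point at least as close
to `X + δ` as some orthographically admissible one, which a Schur complement exhibits at distance
`O(‖δ‖ ^ 2)`, so for small steps the gain of first order survives retraction. -/

namespace RobustPCA

open Matrix

open scoped InnerProductSpace

/-! ### The Frobenius inner product -/

section Frobenius

variable {m n p : Type*} [Fintype m] [Fintype n] [Fintype p]

theorem norm_sq_eq_sum (A : Matrix m n ℝ) : ‖A‖ ^ 2 = ∑ i, ∑ j, A i j ^ 2 := by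
  have h : 0 ≤ ∑ i, ∑ j, A i j ^ 2 := by positivity
  rw [frobenius_norm_def]
  simp only [Real.rpow_two, Real.norm_eq_abs, sq_abs]
  rw [← Real.sqrt_eq_rpow, Real.sq_sqrt h]

/-- The inner product that induces the Frobenius norm, definitionally equal to `frobInner`. It makes
the library of inner product spaces, orthogonal projections in particular, available for
matrices. -/
noncomputable scoped instance frobeniusInnerProductSpace : InnerProductSpace ℝ (Matrix m n ℝ) where
  __ := frobeniusNormedSpace
  inner A B := ∑ i, ∑ j, A i j * B i j
  norm_sq_eq_re_inner A := by rw [norm_sq_eq_sum]; simp only [sq, RCLike.re_to_real]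
  conj_inner_symm A B := by simp only [mul_comm, conj_trivial]
  add_left A B C := by simp only [Matrix.add_apply, add_mul, Finset.sum_add_distrib]
  smul_left A B c := by
    simp only [Matrix.smul_apply, smul_eq_mul, mul_assoc, Finset.mul_sum, conj_trivial]

theorem inner_eq_trace (A B : Matrix m n ℝ) : ⟪A, B⟫_ℝ = trace (Aᵀ * B) := by
  simp only [trace, diag, mul_apply, transpose_apply]
  exact Finset.sum_comm

theorem inner_mul_left (A : Matrix m n ℝ) (B : Matrix n p ℝ) (C : Matrix m p ℝ) :
    ⟪A * B, C⟫_ℝ = ⟪B, Aᵀ * C⟫_ℝ := by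
  simp only [inner_eq_trace, transpose_mul, Matrix.mul_assoc]

theorem inner_mul_right (A : Matrix m n ℝ) (B : Matrix n p ℝ) (C : Matrix m p ℝ) :
    ⟪A * B, C⟫_ℝ = ⟪A, C * Bᵀ⟫_ℝ := by
  simp only [inner_eq_trace, transpose_mul]
  rw [Matrix.mul_assoc, trace_mul_comm, Matrix.mul_assoc]

theorem norm_orthonormal_mul [DecidableEq n] {U : Matrix m n ℝ} (hU : Uᵀ * U = 1)
    (B : Matrix n p ℝ) : ‖U * B‖ = ‖B‖ := by
  rw [← sq_eq_sq₀ (norm_nonneg _) (norm_nonneg _), ← real_inner_self_eq_norm_sq, inner_mul_left,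
    ← Matrix.mul_assoc, hU, Matrix.one_mul, real_inner_self_eq_norm_sq]

end Frobenius

/-! ### Matrices with orthonormal columns -/

section Orthonormal

variable {m n r : Type*} [Fintype r] [DecidableEq m] {U : Matrix m r ℝ}

/-- For `U` with orthonormal columns, the orthogonal projection to the orthogonal complement of the
column space of `U`. -/
def perpProj (U : Matrix m r ℝ) : Matrix m m ℝ := 1 - U * Uᵀ

theorem transpose_perpProj (U : Matrix m r ℝ) : (perpProj U)ᵀ = perpProj U := by
  simp only [perpProj, transpose_sub, transpose_one, transpose_mul, transpose_transpose]

variable [Fintype m]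

theorem mul_transpose_mul_add_perpProj_mul (U : Matrix m r ℝ) (A : Matrix m n ℝ) :
    U * (Uᵀ * A) + perpProj U * A = A := by
  rw [perpProj, Matrix.sub_mul, Matrix.one_mul, Matrix.mul_assoc, add_sub_cancel]

theorem mul_mul_transpose_add_mul_perpProj (U : Matrix m r ℝ) (A : Matrix n m ℝ) :
    A * U * Uᵀ + A * perpProj U = A := by
  rw [perpProj, Matrix.mul_sub, Matrix.mul_one, Matrix.mul_assoc, add_sub_cancel]

variable [DecidableEq r]

theorem perpProj_mul_self (hU : Uᵀ * U = 1) : perpProj U * U = 0 := by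
  rw [perpProj, Matrix.sub_mul, Matrix.one_mul, Matrix.mul_assoc, hU, Matrix.mul_one, sub_self]

theorem transpose_mul_perpProj (hU : Uᵀ * U = 1) : Uᵀ * perpProj U = 0 := by
  simpa only [transpose_mul, transpose_perpProj, transpose_zero] using
    congrArg transpose (perpProj_mul_self hU)

variable [Fintype n]

theorem norm_sq_eq_add_perpProj_mul (hU : Uᵀ * U = 1) (A : Matrix m n ℝ) :
    ‖A‖ ^ 2 = ‖Uᵀ * A‖ ^ 2 + ‖perpProj U * A‖ ^ 2 := by
  have h0 : ⟪U * (Uᵀ * A), perpProj U * A⟫_ℝ = 0 := by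
    rw [inner_mul_left, ← Matrix.mul_assoc, transpose_mul_perpProj hU, Matrix.zero_mul,
      inner_zero_right]
  conv_lhs => rw [← mul_transpose_mul_add_perpProj_mul U A]
  rw [norm_add_sq_real, h0, norm_orthonormal_mul hU, mul_zero, add_zero]

theorem norm_sq_eq_add_mul_perpProj (hU : Uᵀ * U = 1) (A : Matrix n m ℝ) :
    ‖A‖ ^ 2 = ‖A * U‖ ^ 2 + ‖A * perpProj U‖ ^ 2 := by
  rw [← frobenius_norm_transpose A, norm_sq_eq_add_perpProj_mul hU,
    ← frobenius_norm_transpose (A * U), ← frobenius_norm_transpose (A * perpProj U)]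
  simp only [transpose_mul, transpose_perpProj]

theorem norm_perpProj_mul_le (hU : Uᵀ * U = 1) (A : Matrix m n ℝ) : ‖perpProj U * A‖ ≤ ‖A‖ :=
  le_of_sq_le_sq (by linarith [norm_sq_eq_add_perpProj_mul hU A, sq_nonneg ‖Uᵀ * A‖])
    (norm_nonneg _)

theorem norm_mul_perpProj_le (hU : Uᵀ * U = 1) (A : Matrix n m ℝ) : ‖A * perpProj U‖ ≤ ‖A‖ :=
  le_of_sq_le_sq (by linarith [norm_sq_eq_add_mul_perpProj hU A, sq_nonneg ‖A * U‖])
    (norm_nonneg _)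

theorem norm_sq_eq_sum_blocks [DecidableEq n] {V : Matrix n r ℝ} (hU : Uᵀ * U = 1)
    (hV : Vᵀ * V = 1) (D : Matrix m n ℝ) :
    ‖D‖ ^ 2 = ‖Uᵀ * D * V‖ ^ 2 + ‖Uᵀ * D * perpProj V‖ ^ 2 +
      (‖perpProj U * D * V‖ ^ 2 + ‖perpProj U * D * perpProj V‖ ^ 2) := by
  rw [norm_sq_eq_add_perpProj_mul hU, norm_sq_eq_add_mul_perpProj hV (Uᵀ * D),
    norm_sq_eq_add_mul_perpProj hV (perpProj U * D)]

end Orthonormal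

section OrthonormalBound

variable {m n r : Type*} [Fintype m] [Fintype n] [Fintype r] [DecidableEq r] {U : Matrix m r ℝ}

theorem norm_transpose_mul_le (hU : Uᵀ * U = 1) (A : Matrix m n ℝ) : ‖Uᵀ * A‖ ≤ ‖A‖ := by
  classical
  exact le_of_sq_le_sq (by linarith [norm_sq_eq_add_perpProj_mul hU A, sq_nonneg ‖perpProj U * A‖])
    (norm_nonneg _)

theorem norm_mul_orthonormal_le (hU : Uᵀ * U = 1) (A : Matrix n m ℝ) : ‖A * U‖ ≤ ‖A‖ := by
  classical
  exact le_of_sq_le_sq (by linarith [norm_sq_eq_add_mul_perpProj hU A, sq_nonneg ‖A * perpProj U‖])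
    (norm_nonneg _)

end OrthonormalBound

/-! ### Matrices that are bounded below -/

section BoundedBelow

variable {l m n : Type*} [Fintype l] [Fintype m] [Fintype n] [DecidableEq n] {σ : ℝ}

theorem norm_toEuclideanLin_le (E : Matrix m n ℝ) (x : EuclideanSpace ℝ n) :
    ‖toEuclideanLin E x‖ ≤ ‖E‖ * ‖x‖ := by
  have h := frobenius_norm_mul E (replicateCol Unit x.ofLp)
  rw [← replicateCol_mulVec, frobenius_norm_replicateCol, frobenius_norm_replicateCol] at h
  exact h

/-- `σ * ‖x‖ ≤ ‖M x‖` for all vectors `x`: for `0 ≤ σ`, all singular values of `M` are at least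
`σ`. -/
def BoundedBelow (σ : ℝ) (M : Matrix m n ℝ) : Prop :=
  ∀ x : EuclideanSpace ℝ n, σ * ‖x‖ ≤ ‖toEuclideanLin M x‖

theorem BoundedBelow.mul_norm_le {M : Matrix m n ℝ} (h : BoundedBelow σ M) (hσ : 0 ≤ σ)
    (B : Matrix n l ℝ) : σ * ‖B‖ ≤ ‖M * B‖ := by
  have hcol : ∀ j, σ ^ 2 * ∑ k, B k j ^ 2 ≤ ∑ i, (M * B) i j ^ 2 := fun j => by
    have := pow_le_pow_left₀ (by positivity) (h (WithLp.toLp 2 fun k => B k j)) 2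
    rw [mul_pow, EuclideanSpace.real_norm_sq_eq, EuclideanSpace.real_norm_sq_eq] at this
    exact this
  refine le_of_sq_le_sq ?_ (norm_nonneg _)
  rw [mul_pow, norm_sq_eq_sum, norm_sq_eq_sum, Finset.sum_comm, Finset.mul_sum,
    Finset.sum_comm (f := fun i j => (M * B) i j ^ 2)]
  exact Finset.sum_le_sum fun j _ => hcol j

theorem BoundedBelow.add {M : Matrix m n ℝ} (h : BoundedBelow σ M) (E : Matrix m n ℝ) :
    BoundedBelow (σ - ‖E‖) (M + E) := fun x => by
  have hsub : ‖toEuclideanLin M x‖ ≤ ‖toEuclideanLin (M + E) x‖ + ‖toEuclideanLin E x‖ := by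
    rw [map_add, LinearMap.add_apply]
    simpa only [add_sub_cancel_right] using norm_sub_le (toEuclideanLin M x + toEuclideanLin E x)
      (toEuclideanLin E x)
  linarith [h x, norm_toEuclideanLin_le E x]

theorem BoundedBelow.isUnit_det {M : Matrix n n ℝ} (h : BoundedBelow σ M) (hσ : 0 < σ) :
    IsUnit M.det := by
  rw [← isUnit_iff_isUnit_det, ← mulVec_injective_iff_isUnit]
  refine (injective_iff_map_eq_zero (mulVecLin M)).2 fun v hv => ?_
  have hx := h (WithLp.toLp 2 v)
  rw [show toEuclideanLin M (WithLp.toLp 2 v) = 0 from congrArg (WithLp.toLp 2) hv,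
    norm_zero] at hx
  have : ‖WithLp.toLp 2 v‖ = 0 := by nlinarith [norm_nonneg (WithLp.toLp 2 v)]
  simpa using this

theorem BoundedBelow.norm_inv_mul_le {M : Matrix n n ℝ} (h : BoundedBelow σ M) (hσ : 0 < σ)
    (B : Matrix n l ℝ) : σ * ‖M⁻¹ * B‖ ≤ ‖B‖ := by
  have := h.mul_norm_le hσ.le (M⁻¹ * B)
  rwa [mul_nonsing_inv_cancel_left _ _ (h.isUnit_det hσ)] at this

end BoundedBelow

/-! ### Singular values -/

section SingularValues

variable {E F : Type*} [NormedAddCommGroup E] [InnerProductSpace ℝ E] [FiniteDimensional ℝ E]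
  [NormedAddCommGroup F] [InnerProductSpace ℝ F] [FiniteDimensional ℝ F]

theorem exists_orthonormalBasis_norm_sq_eq (T : E →ₗ[ℝ] F) :
    ∃ b : OrthonormalBasis (Fin (Module.finrank ℝ E)) ℝ E,
      ∀ x, ‖T x‖ ^ 2 = ∑ i : Fin _, T.singularValues i ^ 2 * ⟪b i, x⟫_ℝ ^ 2 := by
  have hT := T.isSymmetric_adjoint_comp_self
  let b := hT.eigenvectorBasis rfl
  have hb : ∀ i, (LinearMap.adjoint T ∘ₗ T) (b i) = (T.singularValues i ^ 2) • b i := fun i => by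
    rw [T.sq_singularValues_fin rfl i]
    exact hT.apply_eigenvectorBasis rfl i
  refine ⟨b, fun x => ?_⟩
  rw [← real_inner_self_eq_norm_sq, ← LinearMap.adjoint_inner_left, ← LinearMap.comp_apply,
    ← b.sum_inner_mul_inner]
  refine Finset.sum_congr rfl fun i _ => ?_
  rw [hT x (b i), hb i, real_inner_smul_right, real_inner_comm]
  ring

theorem le_singularValues_of_lt_finrank (T : E →ₗ[ℝ] F) {S : Submodule ℝ E} {k : ℕ} {τ : ℝ}
    (hk : k < Module.finrank ℝ S) (hS : ∀ x ∈ S, τ * ‖x‖ ≤ ‖T x‖) : τ ≤ T.singularValues k := by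
  obtain ⟨b, hb⟩ := exists_orthonormalBasis_norm_sq_eq T
  have hkE : k ≤ Module.finrank ℝ E := hk.le.trans S.finrank_le
  let coords : S →ₗ[ℝ] Fin k → ℝ :=
    LinearMap.pi fun i => (innerₛₗ ℝ (b (i.castLE hkE))).comp S.subtype
  obtain ⟨x, hx, hx0⟩ := (Submodule.ne_bot_iff _).1 <|
    LinearMap.ker_ne_bot_of_finrank_lt (f := coords) (by simpa using hk)
  have hcoord : ∀ i : Fin (Module.finrank ℝ E), (i : ℕ) < k → ⟪b i, (x : E)⟫_ℝ = 0 :=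
    fun i hi => congrFun hx ⟨i, hi⟩
  have hupper : ‖T x‖ ≤ T.singularValues k * ‖(x : E)‖ := by
    refine le_of_sq_le_sq ?_ (mul_nonneg (T.singularValues_nonneg k) (norm_nonneg _))
    rw [hb, mul_pow, ← b.sum_sq_inner_right (x : E), Finset.mul_sum]
    refine Finset.sum_le_sum fun i _ => ?_
    rcases lt_or_ge (i : ℕ) k with hi | hi
    · simp [hcoord i hi]
    · gcongr
      · exact T.singularValues_nonneg _
      · exact T.singularValues_antitone hi
  have hxpos : 0 < ‖(x : E)‖ := norm_pos_iff.2 (by simpa using hx0)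
  exact le_of_mul_le_mul_right ((hS x x.2).trans hupper) hxpos

theorem exists_finrank_eq_and_singularValues_mul_norm_le (T : E →ₗ[ℝ] F) {k : ℕ}
    (hk : k < Module.finrank ℝ E) :
    ∃ S : Submodule ℝ E, Module.finrank ℝ S = k + 1 ∧
      ∀ x ∈ S, T.singularValues k * ‖x‖ ≤ ‖T x‖ := by
  obtain ⟨b, hb⟩ := exists_orthonormalBasis_norm_sq_eq T
  let v : Fin (k + 1) → E := fun i => b (i.castLE hk)
  have hv : LinearIndependent ℝ v :=
    b.orthonormal.linearIndependent.comp _ (Fin.castLE_injective hk)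
  refine ⟨Submodule.span ℝ (Set.range v), by simpa using finrank_span_eq_card hv, fun x hx => ?_⟩
  have hcoord : ∀ j : Fin (Module.finrank ℝ E), k < j → ⟪b j, x⟫_ℝ = 0 := fun j hj => by
    have : Submodule.span ℝ (Set.range v) ≤ LinearMap.ker (innerₛₗ ℝ (b j)) := by
      rw [Submodule.span_le]
      rintro _ ⟨i, rfl⟩
      refine b.orthonormal.2 fun h => ?_
      have hji : (j : ℕ) = i := congrArg Fin.val h
      omega
    exact this hx
  refine le_of_sq_le_sq ?_ (norm_nonneg _)
  rw [hb, mul_pow, ← b.sum_sq_inner_right x, Finset.mul_sum]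
  refine Finset.sum_le_sum fun i _ => ?_
  rcases lt_or_ge k (i : ℕ) with hi | hi
  · simp [hcoord i hi]
  · gcongr
    · exact T.singularValues_nonneg _
    · exact T.singularValues_antitone hi

theorem singularValues_le_add {T T' : E →ₗ[ℝ] F} {c : ℝ} (hT : ∀ x, ‖T x - T' x‖ ≤ c * ‖x‖)
    (hc : 0 ≤ c) (k : ℕ) : T.singularValues k ≤ T'.singularValues k + c := by
  rcases le_or_gt (Module.finrank ℝ E) k with hk | hk
  · rw [T.singularValues_of_finrank_le hk, T'.singularValues_of_finrank_le hk, zero_add]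
    exact hc
  obtain ⟨S, hS, hTS⟩ := exists_finrank_eq_and_singularValues_mul_norm_le T hk
  rw [← sub_le_iff_le_add]
  refine le_singularValues_of_lt_finrank T' (S := S) (by omega) fun x hx => ?_
  linarith [hTS x hx, hT x, norm_sub_norm_le (T x) (T' x)]

end SingularValues

section SingularValue

variable {n₁ n₂ r : ℕ} {X Z : Mat n₁ n₂}

theorem finrank_range_toEuclideanLin {m n : Type*} [Finite m] [Fintype n] [DecidableEq n]
    (X : Matrix m n ℝ) :
    Module.finrank ℝ (LinearMap.range (toEuclideanLin X)) = X.rank := by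
  cases nonempty_fintype m
  rw [rank_eq_finrank_range_toLin X (EuclideanSpace.basisFun _ ℝ).toBasis
    (EuclideanSpace.basisFun _ ℝ).toBasis, toEuclideanLin_eq_toLin_orthonormal]

theorem singularValue_pos_iff (hr : 1 ≤ r) : 0 < singularValue r X ↔ r ≤ X.rank := by
  rw [singularValue, LinearMap.singularValues_pos_iff_lt_finrank_range,
    finrank_range_toEuclideanLin]
  omega

theorem singularValue_le_add_norm_sub (r : ℕ) (X Z : Mat n₁ n₂) :
    singularValue r X ≤ singularValue r Z + ‖X - Z‖ :=
  singularValues_le_add (fun x => by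
    rw [← LinearMap.sub_apply, ← map_sub]
    exact norm_toEuclideanLin_le _ x) (norm_nonneg _) _

theorem le_rank_of_norm_sub_lt (hZ : ‖X - Z‖ < singularValue r X) : r ≤ Z.rank := by
  rcases Nat.eq_zero_or_pos r with rfl | hr
  · exact Nat.zero_le _
  · exact (singularValue_pos_iff hr).1 (by linarith [singularValue_le_add_norm_sub r X Z])

theorem isClosed_setOf_rank_le (n₁ n₂ k : ℕ) : IsClosed {X : Mat n₁ n₂ | X.rank ≤ k} := by
  have hlip : LipschitzWith 1 (singularValue (k + 1) : Mat n₁ n₂ → ℝ) :=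
    LipschitzWith.of_le_add fun X Z => by
      rw [dist_eq_norm]
      exact singularValue_le_add_norm_sub (k + 1) X Z
  have : {X : Mat n₁ n₂ | X.rank ≤ k} = {X | singularValue (k + 1) X ≤ 0} := by
    ext X
    rw [Set.mem_ofPred_eq, Set.mem_ofPred_eq, ← not_lt, ← not_lt, not_iff_not,
      singularValue_pos_iff le_add_self, Nat.succ_le_iff]
  rw [this]
  exact isClosed_le hlip.continuous continuous_const

end SingularValue

/-! ### Compression to the row and column spaces -/

section Compression

variable {m n : Type*} [Fintype m] [Fintype n] {r : ℕ}

theorem norm_toEuclideanLin_orthonormal [DecidableEq n] {U : Matrix m n ℝ} (hU : Uᵀ * U = 1)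
    (x : EuclideanSpace ℝ n) : ‖toEuclideanLin U x‖ = ‖x‖ := by
  have h := norm_orthonormal_mul hU (replicateCol Unit x.ofLp)
  rw [← replicateCol_mulVec, frobenius_norm_replicateCol, frobenius_norm_replicateCol] at h
  exact h

theorem norm_toEuclideanLin_transpose_orthonormal_le [DecidableEq m] [DecidableEq n]
    {V : Matrix m n ℝ} (hV : Vᵀ * V = 1) (x : EuclideanSpace ℝ m) :
    ‖toEuclideanLin Vᵀ x‖ ≤ ‖x‖ := by
  have h := norm_transpose_mul_le hV (replicateCol Unit x.ofLp)
  rw [← replicateCol_mulVec, frobenius_norm_replicateCol, frobenius_norm_replicateCol] at h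
  exact h

theorem exists_orthonormal_columns [DecidableEq m] {X : Matrix m n ℝ} (hX : X.rank = r) :
    ∃ U : Matrix m (Fin r) ℝ, Uᵀ * U = 1 ∧ perpProj U * X = 0 := by
  classical
  set K := LinearMap.range (toEuclideanLin X)
  have hdim : Module.finrank ℝ K = r := (finrank_range_toEuclideanLin X).trans hX
  let b : OrthonormalBasis (Fin r) ℝ K := (stdOrthonormalBasis ℝ K).reindex (finCongr hdim)
  have hb : ∀ k l, ∑ i, (b k : EuclideanSpace ℝ m) i * (b l : EuclideanSpace ℝ m) i =
      if k = l then 1 else 0 := fun k l => by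
    rw [← orthonormal_iff_ite.1 b.orthonormal k l, Submodule.coe_inner, PiLp.inner_apply]
    exact Finset.sum_congr rfl fun i _ => mul_comm _ _
  refine ⟨of fun i k => (b k : EuclideanSpace ℝ m) i, ?_, ?_⟩
  · ext k l
    simp [mul_apply, hb, one_apply]
  · rw [perpProj, Matrix.sub_mul, Matrix.one_mul, sub_eq_zero, Matrix.mul_assoc]
    ext i j
    let y : K := ⟨toEuclideanLin X (EuclideanSpace.single j 1), LinearMap.mem_range_self _ _⟩
    have hy : ∀ i, (y : EuclideanSpace ℝ m) i = X i j := fun i => by simp [y, toLpLin_apply]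
    have h := congrArg (fun z : K => (z : EuclideanSpace ℝ m) i) (b.sum_repr' y)
    simp only [Submodule.coe_sum, Submodule.coe_smul, hy, Submodule.coe_inner,
      PiLp.inner_apply] at h
    rw [← h]
    simp [mul_apply, mul_comm]

theorem le_rank_of_isUnit_det {Z : Matrix m n ℝ} {U : Matrix m (Fin r) ℝ}
    {V : Matrix n (Fin r) ℝ} (h : IsUnit (Uᵀ * Z * V).det) : r ≤ Z.rank :=
  calc r = (Uᵀ * Z * V).rank := by
        rw [rank_of_isUnit _ ((isUnit_iff_isUnit_det _).2 h), Fintype.card_fin]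
    _ ≤ (Uᵀ * Z).rank := rank_mul_le_left _ _
    _ ≤ Z.rank := rank_mul_le_right _ _

theorem eq_mul_inv_mul_of_rank_eq {Z : Matrix m n ℝ} {U : Matrix m (Fin r) ℝ}
    {V : Matrix n (Fin r) ℝ} (hZ : Z.rank = r) (hN : IsUnit (Uᵀ * Z * V).det) :
    Z = Z * V * (Uᵀ * Z * V)⁻¹ * (Uᵀ * Z) := by
  classical
  obtain ⟨W, -, hWZ⟩ := exists_orthonormal_columns hZ
  have hW : W * (Wᵀ * Z) = Z := by
    simpa only [hWZ, add_zero] using mul_transpose_mul_add_perpProj_mul W Z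
  set C := Wᵀ * Z
  have hNe : Uᵀ * Z * V = (Uᵀ * W) * (C * V) := by
    conv_lhs => rw [← hW]
    simp only [Matrix.mul_assoc]
  have hdet : IsUnit ((Uᵀ * W).det * (C * V).det) := by rwa [← det_mul, ← hNe]
  calc Z = W * C := hW.symm
    _ = W * ((C * V) * (C * V)⁻¹) * ((Uᵀ * W)⁻¹ * (Uᵀ * W)) * C := by
      rw [mul_nonsing_inv _ (isUnit_of_mul_isUnit_right hdet),
        nonsing_inv_mul _ (isUnit_of_mul_isUnit_left hdet), Matrix.mul_one, Matrix.mul_one]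
    _ = (W * C) * V * (Uᵀ * Z * V)⁻¹ * (Uᵀ * (W * C)) := by
      rw [hNe, Matrix.mul_inv_rev]; simp only [Matrix.mul_assoc]
    _ = Z * V * (Uᵀ * Z * V)⁻¹ * (Uᵀ * Z) := by rw [hW]

theorem exists_rank_eq_of_isUnit_det {H : Matrix m n ℝ} {U : Matrix m (Fin r) ℝ}
    {V : Matrix n (Fin r) ℝ} (hN : IsUnit (Uᵀ * H * V).det) :
    ∃ Z : Matrix m n ℝ, Z.rank = r ∧ Uᵀ * Z = Uᵀ * H ∧ Z * V = H * V := by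
  set N := Uᵀ * H * V with hNdef
  set Z := H * V * N⁻¹ * (Uᵀ * H) with hZ
  have hUZ : Uᵀ * Z = Uᵀ * H := by
    calc Uᵀ * Z = (N * N⁻¹) * (Uᵀ * H) := by rw [hZ, hNdef]; simp only [Matrix.mul_assoc]
      _ = Uᵀ * H := by rw [mul_nonsing_inv _ hN, Matrix.one_mul]
  have hZV : Z * V = H * V := by
    calc Z * V = H * V * (N⁻¹ * N) := by rw [hZ, hNdef]; simp only [Matrix.mul_assoc]
      _ = H * V := by rw [nonsing_inv_mul _ hN, Matrix.mul_one]
  have hle : Z.rank ≤ r :=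
    calc Z.rank ≤ (H * V * N⁻¹).rank := rank_mul_le_left _ _
      _ ≤ r := (rank_le_card_width _).trans (Fintype.card_fin r).le
  exact ⟨Z, hle.antisymm (le_rank_of_isUnit_det (U := U) (V := V) (by rwa [hUZ])), hUZ, hZV⟩

theorem BoundedBelow.mul_norm_perpProj_mul_perpProj_le [DecidableEq m] [DecidableEq n] {τ : ℝ}
    {Z : Matrix m n ℝ} {U : Matrix m (Fin r) ℝ} {V : Matrix n (Fin r) ℝ}
    (h : BoundedBelow τ (Uᵀ * Z * V)) (hτ : 0 < τ) (hZ : Z.rank = r) :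
    τ * ‖perpProj U * Z * perpProj V‖ ≤ ‖perpProj U * Z * V‖ * ‖Uᵀ * Z * perpProj V‖ := by
  set N := Uᵀ * Z * V
  have heq : perpProj U * Z * perpProj V =
      (perpProj U * Z * V) * (N⁻¹ * (Uᵀ * Z * perpProj V)) := by
    conv_lhs => rw [eq_mul_inv_mul_of_rank_eq hZ (h.isUnit_det hτ)]
    simp only [N, Matrix.mul_assoc]
  calc τ * ‖perpProj U * Z * perpProj V‖
      ≤ τ * (‖perpProj U * Z * V‖ * ‖N⁻¹ * (Uᵀ * Z * perpProj V)‖) := by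
        rw [heq]
        gcongr
        exact frobenius_norm_mul _ _
    _ = ‖perpProj U * Z * V‖ * (τ * ‖N⁻¹ * (Uᵀ * Z * perpProj V)‖) := by ring
    _ ≤ ‖perpProj U * Z * V‖ * ‖Uᵀ * Z * perpProj V‖ := by
        gcongr
        exact h.norm_inv_mul_le hτ _

end Compression

/-- The columns of `U` and of `V` are orthonormal, and span spaces containing the column space and
the row space of `X`, respectively. Then `Uᵀ * X * V` represents `X`, as the middle factor of a
compact singular value decomposition does, but need not be diagonal. -/
structure IsOrthonormalFrame {n₁ n₂ r : ℕ} (X : Mat n₁ n₂) (U : Mat n₁ r) (V : Mat n₂ r) :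
    Prop where
  left_orthonormal : Uᵀ * U = 1
  right_orthonormal : Vᵀ * V = 1
  perpProj_mul : perpProj U * X = 0
  mul_perpProj : X * perpProj V = 0

theorem exists_isOrthonormalFrame {n₁ n₂ r : ℕ} {X : Mat n₁ n₂} (hX : X.rank = r) :
    ∃ (U : Mat n₁ r) (V : Mat n₂ r), IsOrthonormalFrame X U V := by
  obtain ⟨U, hU, hUX⟩ := exists_orthonormal_columns hX
  obtain ⟨V, hV, hVX⟩ := exists_orthonormal_columns ((rank_transpose X).trans hX)
  refine ⟨U, V, hU, hV, hUX, ?_⟩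
  simpa only [transpose_mul, transpose_transpose, transpose_perpProj, transpose_zero] using
    congrArg transpose hVX

theorem IsSVD.isOrthonormalFrame {n₁ n₂ r : ℕ} {L : Mat n₁ n₂} {U : Mat n₁ r} {s : Fin r → ℝ}
    {V : Mat n₂ r} (h : IsSVD L U s V) : IsOrthonormalFrame L U V where
  left_orthonormal := h.left_orthonormal
  right_orthonormal := h.right_orthonormal
  perpProj_mul := by
    rw [h.eq, ← Matrix.mul_assoc, ← Matrix.mul_assoc, perpProj_mul_self h.left_orthonormal,
      Matrix.zero_mul, Matrix.zero_mul]
  mul_perpProj := by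
    rw [h.eq, Matrix.mul_assoc, transpose_mul_perpProj h.right_orthonormal, Matrix.mul_zero]

namespace IsOrthonormalFrame

variable {n₁ n₂ r : ℕ} {X Z : Mat n₁ n₂} {U : Mat n₁ r} {V : Mat n₂ r}

theorem eq_mul_compression_mul (h : IsOrthonormalFrame X U V) : X = U * (Uᵀ * X * V) * Vᵀ := by
  have hU : U * (Uᵀ * X) = X := by
    simpa only [h.perpProj_mul, add_zero] using mul_transpose_mul_add_perpProj_mul U X
  have hV : X * V * Vᵀ = X := by
    simpa only [h.mul_perpProj, add_zero] using mul_mul_transpose_add_mul_perpProj V X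
  calc X = U * (Uᵀ * (X * V * Vᵀ)) := by rw [hV, hU]
    _ = U * (Uᵀ * X * V) * Vᵀ := by simp only [Matrix.mul_assoc]

theorem norm_toEuclideanLin_eq (h : IsOrthonormalFrame X U V) (x : EuclideanSpace ℝ (Fin n₂)) :
    ‖toEuclideanLin X x‖ = ‖toEuclideanLin (Uᵀ * X * V) (toEuclideanLin Vᵀ x)‖ := by
  conv_lhs => rw [h.eq_mul_compression_mul]
  rw [toLpLin_mul_same, toLpLin_mul_same, LinearMap.comp_apply, LinearMap.comp_apply,
    norm_toEuclideanLin_orthonormal h.left_orthonormal]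

/-- `X` is bounded below by its `r`-th singular value on an `r`-dimensional space, which `Vᵀ` maps
onto `ℝ^r` without increasing norms. -/
theorem boundedBelow (h : IsOrthonormalFrame X U V) :
    BoundedBelow (singularValue r X) (Uᵀ * X * V) := fun y => by
  rcases r.eq_zero_or_pos with rfl | hr
  · rw [Subsingleton.elim y 0, norm_zero, mul_zero]
    exact norm_nonneg _
  rcases ((toEuclideanLin X).singularValues_nonneg (r - 1)).eq_or_lt with h0 | hpos
  · rw [singularValue, ← h0, zero_mul]
    exact norm_nonneg _
  have hlt : r - 1 < Module.finrank ℝ (EuclideanSpace ℝ (Fin n₂)) := by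
    by_contra! hle
    exact hpos.ne' ((toEuclideanLin X).singularValues_of_finrank_le hle)
  obtain ⟨S, hS, hXS⟩ := exists_finrank_eq_and_singularValues_mul_norm_le (toEuclideanLin X) hlt
  let φ : S →ₗ[ℝ] EuclideanSpace ℝ (Fin r) := (toEuclideanLin Vᵀ).comp S.subtype
  have hφ : Function.Injective φ := (injective_iff_map_eq_zero φ).2 fun x hx => by
    have hx' : toEuclideanLin Vᵀ (x : EuclideanSpace ℝ (Fin n₂)) = 0 := hx
    have hle := hXS x x.2
    rw [h.norm_toEuclideanLin_eq, hx', map_zero, norm_zero] at hle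
    have : ‖(x : EuclideanSpace ℝ (Fin n₂))‖ = 0 := by
      nlinarith [norm_nonneg (x : EuclideanSpace ℝ (Fin n₂))]
    simpa using this
  have hdim : Module.finrank ℝ S = Module.finrank ℝ (EuclideanSpace ℝ (Fin r)) := by
    rw [hS, finrank_euclideanSpace_fin]
    omega
  obtain ⟨x, rfl⟩ := (LinearMap.injective_iff_surjective_of_finrank_eq_finrank hdim).1 hφ y
  calc singularValue r X * ‖φ x‖
      ≤ singularValue r X * ‖(x : EuclideanSpace ℝ (Fin n₂))‖ :=
        mul_le_mul_of_nonneg_left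
          (norm_toEuclideanLin_transpose_orthonormal_le h.right_orthonormal _) hpos.le
    _ ≤ ‖toEuclideanLin X x‖ := hXS x x.2
    _ = ‖toEuclideanLin (Uᵀ * X * V) (φ x)‖ := h.norm_toEuclideanLin_eq _

theorem boundedBelow_add (h : IsOrthonormalFrame X U V) (D : Mat n₁ n₂) :
    BoundedBelow (singularValue r X - ‖Uᵀ * D * V‖) (Uᵀ * (X + D) * V) := by
  rw [Matrix.mul_add, Matrix.add_mul]
  exact h.boundedBelow.add _

theorem norm_compression_le (h : IsOrthonormalFrame X U V) (D : Mat n₁ n₂) :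
    ‖Uᵀ * D * V‖ ≤ ‖D‖ :=
  (norm_mul_orthonormal_le h.right_orthonormal _).trans
    (norm_transpose_mul_le h.left_orthonormal _)

theorem mul_norm_perpProj_mul_perpProj_le (h : IsOrthonormalFrame X U V) {D : Mat n₁ n₂}
    (hD : ‖Uᵀ * D * V‖ < singularValue r X) (hZ : Z.rank = r) (hU : Uᵀ * Z = Uᵀ * (X + D))
    (hV : Z * V = (X + D) * V) :
    (singularValue r X - ‖Uᵀ * D * V‖) * ‖perpProj U * Z * perpProj V‖ ≤
      ‖perpProj U * D * V‖ * ‖Uᵀ * D * perpProj V‖ := by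
  have hb := h.boundedBelow_add D
  rw [← hU] at hb
  have hle := hb.mul_norm_perpProj_mul_perpProj_le (sub_pos.2 hD) hZ
  have hleft : perpProj U * Z * V = perpProj U * D * V := by
    rw [Matrix.mul_assoc, hV, ← Matrix.mul_assoc, Matrix.mul_add, h.perpProj_mul, zero_add]
  have hright : Uᵀ * Z * perpProj V = Uᵀ * D * perpProj V := by
    rw [hU, Matrix.mul_assoc, Matrix.add_mul, h.mul_perpProj, zero_add, Matrix.mul_assoc]
  rwa [hleft, hright] at hle

end IsOrthonormalFrame

/-! ### The tangent space -/

/-- `tangentSpace X` as a submodule, so that the orthogonal projections to it and to the normal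
space `(tangentSubmodule X)ᗮ` are those of Mathlib. -/
def tangentSubmodule {n₁ n₂ : ℕ} (X : Mat n₁ n₂) : Submodule ℝ (Mat n₁ n₂) where
  carrier := tangentSpace X
  zero_mem' := ⟨0, 0, by rw [Matrix.zero_mul, Matrix.mul_zero, add_zero]⟩
  add_mem' := by
    rintro _ _ ⟨A, B, rfl⟩ ⟨A', B', rfl⟩
    exact ⟨A + A', B + B', by rw [Matrix.add_mul, Matrix.mul_add]; abel⟩
  smul_mem' := by
    rintro c _ ⟨A, B, rfl⟩
    exact ⟨c • A, c • B, by rw [smul_add, Matrix.smul_mul, Matrix.mul_smul]⟩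

section Tangent

variable {n₁ n₂ r : ℕ} {X Z δ G P E : Mat n₁ n₂} {U : Mat n₁ r} {V : Mat n₂ r}

theorem isTangentProjection_iff :
    IsTangentProjection X G P ↔ (tangentSubmodule X).starProjection G = P := by
  constructor
  · rintro ⟨hP, horth⟩
    exact Submodule.eq_starProjection_of_mem_of_inner_eq_zero hP horth
  · rintro rfl
    exact ⟨(tangentSubmodule X).starProjection_apply_mem G,
      fun W hW => Submodule.starProjection_inner_eq_zero _ W hW⟩

theorem isOrthographicAdmissible_iff :
    IsOrthographicAdmissible r X δ Z ↔ Z.rank = r ∧ Z - (X + δ) ∈ (tangentSubmodule X)ᗮ := by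
  rw [IsOrthographicAdmissible, Submodule.mem_orthogonal', sub_sub]
  rfl

theorem mem_orthogonal_tangentSubmodule_iff :
    E ∈ (tangentSubmodule X)ᗮ ↔ Xᵀ * E = 0 ∧ E * Xᵀ = 0 := by
  rw [Submodule.mem_orthogonal]
  constructor
  · intro hE
    have hleft : ⟪Xᵀ * E, Xᵀ * E⟫_ℝ = 0 := by
      rw [← inner_mul_left]
      exact hE _ ⟨0, Xᵀ * E, by rw [Matrix.zero_mul, zero_add]⟩
    have hright : ⟪E * Xᵀ, E * Xᵀ⟫_ℝ = 0 := by
      rw [← inner_mul_right]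
      exact hE _ ⟨E * Xᵀ, 0, by rw [Matrix.mul_zero, add_zero]⟩
    exact ⟨inner_self_eq_zero.1 hleft, inner_self_eq_zero.1 hright⟩
  · rintro ⟨hleft, hright⟩ _ ⟨A, B, rfl⟩
    rw [inner_add_left, inner_mul_right, inner_mul_left, hleft, hright, inner_zero_right,
      inner_zero_right, add_zero]

theorem IsOrthonormalFrame.mem_orthogonal_tangentSubmodule_iff (h : IsOrthonormalFrame X U V)
    (hM : IsUnit (Uᵀ * X * V).det) :
    E ∈ (tangentSubmodule X)ᗮ ↔ Uᵀ * E = 0 ∧ E * V = 0 := by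
  have hX : Xᵀ = V * (Uᵀ * X * V)ᵀ * Uᵀ := by
    conv_lhs => rw [h.eq_mul_compression_mul]
    rw [transpose_mul, transpose_mul, transpose_transpose]
    exact (Matrix.mul_assoc _ _ _).symm
  have hM' : IsUnit ((Uᵀ * X * V)ᵀ).det := by rwa [det_transpose]
  rw [RobustPCA.mem_orthogonal_tangentSubmodule_iff]
  generalize (Uᵀ * X * V)ᵀ = N at hX hM'
  rw [hX]
  constructor
  · rintro ⟨hleft, hright⟩
    constructor
    · calc Uᵀ * E = N⁻¹ * ((Vᵀ * V) * N * (Uᵀ * E)) := by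
            rw [h.right_orthonormal, Matrix.one_mul, nonsing_inv_mul_cancel_left _ _ hM']
        _ = N⁻¹ * (Vᵀ * (V * N * Uᵀ * E)) := by simp only [Matrix.mul_assoc]
        _ = 0 := by rw [hleft, Matrix.mul_zero, Matrix.mul_zero]
    · calc E * V = E * V * N * (Uᵀ * U) * N⁻¹ := by
            rw [h.left_orthonormal, Matrix.mul_one, mul_nonsing_inv_cancel_right _ _ hM']
        _ = E * (V * N * Uᵀ) * U * N⁻¹ := by simp only [Matrix.mul_assoc]
        _ = 0 := by rw [hright, Matrix.zero_mul, Matrix.zero_mul]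
  · rintro ⟨hleft, hright⟩
    constructor
    · rw [Matrix.mul_assoc, hleft, Matrix.mul_zero]
    · rw [← Matrix.mul_assoc, ← Matrix.mul_assoc, hright, Matrix.zero_mul, Matrix.zero_mul]

theorem perpProj_mul_mul_perpProj_eq_self (hU : Uᵀ * E = 0) (hV : E * V = 0) :
    perpProj U * E * perpProj V = E := by
  have hleft : perpProj U * E = E := by
    simpa only [hU, Matrix.mul_zero, zero_add] using mul_transpose_mul_add_perpProj_mul U E
  rw [hleft]
  simpa only [hV, Matrix.zero_mul, zero_add] using mul_mul_transpose_add_mul_perpProj V E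

theorem IsOrthonormalFrame.starProjection_orthogonal (h : IsOrthonormalFrame X U V)
    (hM : IsUnit (Uᵀ * X * V).det) (D : Mat n₁ n₂) :
    (tangentSubmodule X)ᗮ.starProjection D = perpProj U * D * perpProj V := by
  refine Submodule.eq_starProjection_of_mem_of_inner_eq_zero ?_ fun E hE => ?_
  · rw [h.mem_orthogonal_tangentSubmodule_iff hM]
    constructor
    · rw [← Matrix.mul_assoc, ← Matrix.mul_assoc, transpose_mul_perpProj h.left_orthonormal,
        Matrix.zero_mul, Matrix.zero_mul]
    · rw [Matrix.mul_assoc, perpProj_mul_self h.right_orthonormal, Matrix.mul_zero]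
  · obtain ⟨hU, hV⟩ := (h.mem_orthogonal_tangentSubmodule_iff hM).1 hE
    rw [inner_sub_left, inner_mul_right, inner_mul_left, transpose_perpProj, transpose_perpProj,
      ← Matrix.mul_assoc, perpProj_mul_mul_perpProj_eq_self hU hV, sub_self]

theorem IsOrthonormalFrame.isUnit_det (h : IsOrthonormalFrame X U V)
    (hσ : 0 < singularValue r X) : IsUnit (Uᵀ * X * V).det :=
  h.boundedBelow.isUnit_det hσ

/-- The manifold of matrices of rank `r` is tangent to second order to its tangent spaces. -/
theorem two_mul_norm_starProjection_orthogonal_le (hX : X.rank = r) (hZ : Z.rank = r)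
    (hlt : ‖Z - X‖ < singularValue r X) :
    2 * singularValue r X * ‖(tangentSubmodule X)ᗮ.starProjection (Z - X)‖ ≤ ‖Z - X‖ ^ 2 := by
  obtain ⟨U, V, h⟩ := exists_isOrthonormalFrame hX
  set D := Z - X with hD
  have hblock := h.mul_norm_perpProj_mul_perpProj_le ((h.norm_compression_le D).trans_lt hlt) hZ
    (by rw [hD, add_sub_cancel]) (by rw [hD, add_sub_cancel])
  have hnormal : perpProj U * D = perpProj U * Z := by
    rw [hD, Matrix.mul_sub, h.perpProj_mul, sub_zero]
  rw [← hnormal] at hblock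
  rw [h.starProjection_orthogonal (h.isUnit_det ((norm_nonneg D).trans_lt hlt))]
  have hpyth := norm_sq_eq_sum_blocks h.left_orthonormal h.right_orthonormal D
  nlinarith [sq_nonneg (‖Uᵀ * D * V‖ - ‖perpProj U * D * perpProj V‖),
    sq_nonneg (‖perpProj U * D * V‖ - ‖Uᵀ * D * perpProj V‖)]

theorem exists_isOrthographicAdmissible (hX : X.rank = r) (hδ : δ ∈ tangentSubmodule X)
    (hlt : ‖δ‖ < singularValue r X) :
    ∃ Z, IsOrthographicAdmissible r X δ Z ∧
      (singularValue r X - ‖δ‖) * ‖X + δ - Z‖ ≤ ‖δ‖ ^ 2 := by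
  obtain ⟨U, V, h⟩ := exists_isOrthonormalFrame hX
  have hM := h.isUnit_det ((norm_nonneg δ).trans_lt hlt)
  have hcomp := h.norm_compression_le δ
  obtain ⟨Z, hZ, hUZ, hZV⟩ := exists_rank_eq_of_isUnit_det
    ((h.boundedBelow_add δ).isUnit_det (sub_pos.2 (hcomp.trans_lt hlt)))
  have hUE : Uᵀ * (Z - (X + δ)) = 0 := by rw [Matrix.mul_sub, hUZ, sub_self]
  have hEV : (Z - (X + δ)) * V = 0 := by rw [Matrix.sub_mul, hZV, sub_self]
  have hperp := (h.mem_orthogonal_tangentSubmodule_iff hM).2 ⟨hUE, hEV⟩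
  refine ⟨Z, isOrthographicAdmissible_iff.2 ⟨hZ, hperp⟩, ?_⟩
  have hδ0 : perpProj U * δ * perpProj V = 0 := by
    rw [← h.starProjection_orthogonal hM]
    exact Submodule.starProjection_orthogonal_apply_eq_zero hδ
  have hE : Z - (X + δ) = perpProj U * Z * perpProj V := by
    rw [← perpProj_mul_mul_perpProj_eq_self hUE hEV, Matrix.mul_sub, Matrix.mul_add,
      h.perpProj_mul, zero_add, Matrix.sub_mul, hδ0, sub_zero]
  calc (singularValue r X - ‖δ‖) * ‖X + δ - Z‖
      = (singularValue r X - ‖δ‖) * ‖perpProj U * Z * perpProj V‖ := by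
        rw [norm_sub_rev, hE]
    _ ≤ (singularValue r X - ‖Uᵀ * δ * V‖) * ‖perpProj U * Z * perpProj V‖ := by gcongr
    _ ≤ ‖perpProj U * δ * V‖ * ‖Uᵀ * δ * perpProj V‖ :=
        h.mul_norm_perpProj_mul_perpProj_le (hcomp.trans_lt hlt) hZ hUZ hZV
    _ ≤ ‖δ‖ * ‖δ‖ := by
        gcongr
        · exact (norm_mul_orthonormal_le h.right_orthonormal _).trans
            (norm_perpProj_mul_le h.left_orthonormal _)
        · exact (norm_mul_perpProj_le h.right_orthonormal _).trans
            (norm_transpose_mul_le h.left_orthonormal _)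
    _ = ‖δ‖ ^ 2 := (sq _).symm

end Tangent

/-! ### Retractions -/

section Retraction

variable {n₁ n₂ r : ℕ} {X δ Z Z₀ : Mat n₁ n₂}

theorem exists_norm_sub_le_of_isClosed {K : Set (Mat n₁ n₂)} (hK : IsClosed K)
    (hne : K.Nonempty) (H : Mat n₁ n₂) : ∃ Z ∈ K, ∀ Z' ∈ K, ‖H - Z‖ ≤ ‖H - Z'‖ := by
  obtain ⟨Z, hZ, hdist⟩ := hK.exists_infDist_eq_dist hne H
  refine ⟨Z, hZ, fun Z' hZ' => ?_⟩
  rw [← dist_eq_norm, ← dist_eq_norm, ← hdist]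
  exact Metric.infDist_le_dist_of_mem hZ'

/-- The matrices of rank `r` are not closed, those of rank at most `r` are: a nearest one among the
latter has rank `r` as soon as all matrices near enough have rank at least `r`. -/
theorem exists_isProjectiveRetraction (hZ₀ : Z₀.rank = r)
    (hrank : ∀ Z, ‖X + δ - Z‖ ≤ ‖X + δ - Z₀‖ → r ≤ Z.rank) :
    ∃ Z, IsProjectiveRetraction r X δ Z := by
  obtain ⟨Z, hZ, hmin⟩ := exists_norm_sub_le_of_isClosed (isClosed_setOf_rank_le n₁ n₂ r)
    ⟨Z₀, hZ₀.le⟩ (X + δ)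
  exact ⟨Z, le_antisymm hZ (hrank Z (hmin Z₀ hZ₀.le)), fun Z' hZ' => hmin Z' hZ'.le⟩

theorem exists_isOrthographicRetraction (hZ₀ : IsOrthographicAdmissible r X δ Z₀)
    (hrank : ∀ Z, ‖X + δ - Z‖ ≤ ‖X + δ - Z₀‖ → r ≤ Z.rank) :
    ∃ Z, IsOrthographicRetraction r X δ Z := by
  have hclosed : IsClosed {Z | Z - (X + δ) ∈ (tangentSubmodule X)ᗮ} :=
    (Submodule.isClosed_orthogonal _).preimage (continuous_id.sub continuous_const)
  simp only [IsOrthographicRetraction, isOrthographicAdmissible_iff] at hZ₀ ⊢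
  obtain ⟨Z, hZ, hmin⟩ := exists_norm_sub_le_of_isClosed
    ((isClosed_setOf_rank_le n₁ n₂ r).inter hclosed) ⟨Z₀, hZ₀.1.le, hZ₀.2⟩ (X + δ)
  exact ⟨Z, ⟨le_antisymm hZ.1 (hrank Z (hmin Z₀ ⟨hZ₀.1.le, hZ₀.2⟩)), hZ.2⟩,
    fun Z' hZ' => hmin Z' ⟨hZ'.1.le, hZ'.2⟩⟩

/-- A retraction by minimization of the distance to `X + δ` over a set of matrices of rank `r` that
contains the orthographically admissible ones: the properties of the projective and of the
orthographic retraction that the convergence proof uses. -/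
structure IsMinimizingRetraction {n₁ n₂ : ℕ} (r : ℕ)
    (R : Mat n₁ n₂ → Mat n₁ n₂ → Mat n₁ n₂ → Prop) : Prop where
  rank_eq : ∀ {X δ Z}, R X δ Z → Z.rank = r
  norm_sub_le : ∀ {X δ Z Z₀}, R X δ Z → IsOrthographicAdmissible r X δ Z₀ →
    ‖X + δ - Z‖ ≤ ‖X + δ - Z₀‖
  exists_of_forall_le_rank : ∀ {X δ Z₀}, IsOrthographicAdmissible r X δ Z₀ →
    (∀ Z, ‖X + δ - Z‖ ≤ ‖X + δ - Z₀‖ → r ≤ Z.rank) → ∃ Z, R X δ Z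

theorem isMinimizingRetraction_isProjectiveRetraction :
    IsMinimizingRetraction r (IsProjectiveRetraction (n₁ := n₁) (n₂ := n₂) r) where
  rank_eq h := h.1
  norm_sub_le h hZ₀ := h.2 _ hZ₀.1
  exists_of_forall_le_rank hZ₀ := exists_isProjectiveRetraction hZ₀.1

theorem isMinimizingRetraction_isOrthographicRetraction :
    IsMinimizingRetraction r (IsOrthographicRetraction (n₁ := n₁) (n₂ := n₂) r) where
  rank_eq h := h.1.1
  norm_sub_le h hZ₀ := h.2 _ hZ₀
  exists_of_forall_le_rank hZ₀ := exists_isOrthographicRetraction hZ₀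

theorem isMinimizingRetraction_of_eq_or_eq {R : Mat n₁ n₂ → Mat n₁ n₂ → Mat n₁ n₂ → Prop}
    (hR : R = IsProjectiveRetraction r ∨ R = IsOrthographicRetraction r) :
    IsMinimizingRetraction r R := by
  rcases hR with rfl | rfl
  exacts [isMinimizingRetraction_isProjectiveRetraction,
    isMinimizingRetraction_isOrthographicRetraction]

end Retraction

/-! ### Hard thresholding -/

section HardThreshold

variable {n n₁ n₂ : ℕ} {γ γs : ℝ}

theorem exists_isPercentile (hγ₀ : 0 ≤ γ) (hγ₁ : γ ≤ 1) (v : Fin n → ℝ) :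
    ∃ t, IsPercentile γ v t := by
  rcases n.eq_zero_or_pos with rfl | hn
  · exact ⟨0, by simp, by simp⟩
  have : NeZero n := ⟨hn.ne'⟩
  set J : Finset (Fin n) := Finset.univ.filter fun j =>
    γ * n ≤ ((Finset.univ.filter fun i => |v j| ≤ |v i|).card : ℝ) with hJ
  have hJne : J.Nonempty := by
    obtain ⟨j, -, hj⟩ := Finset.exists_min_image Finset.univ (fun j => |v j|) Finset.univ_nonempty
    refine ⟨j, Finset.mem_filter.2 ⟨Finset.mem_univ _, ?_⟩⟩
    rw [Finset.filter_true_of_mem hj, Finset.card_univ, Fintype.card_fin]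
    exact mul_le_of_le_one_left (Nat.cast_nonneg _) hγ₁
  obtain ⟨j, hjJ, hmax⟩ := Finset.exists_max_image J (fun j => |v j|) hJne
  refine ⟨|v j|, ?_, (Finset.mem_filter.1 hjJ).2⟩
  rcases (Finset.univ.filter fun i => |v j| < |v i|).eq_empty_or_nonempty with hempty | hne
  · rw [hempty, Finset.card_empty, Nat.cast_zero]
    positivity
  obtain ⟨i, hi, hmin⟩ := Finset.exists_min_image _ (fun j => |v j|) hne
  have hiJ : i ∉ J := fun h => (hmax i h).not_gt (Finset.mem_filter.1 hi).2
  rw [hJ, Finset.mem_filter, not_and, not_le] at hiJ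
  refine le_trans ?_ (hiJ (Finset.mem_univ _)).le
  exact_mod_cast Finset.card_le_card fun k hk =>
    Finset.mem_filter.2 ⟨Finset.mem_univ _, hmin k hk⟩

theorem exists_isTopFraction (hγ₀ : 0 ≤ γ) (hγ₁ : γ ≤ 1) (v : Fin n → ℝ) :
    ∃ T, IsTopFraction γ v T := by
  obtain ⟨t, ht⟩ := exists_isPercentile hγ₀ hγ₁ v
  exact ⟨Finset.univ.filter fun j => t < |v j|, ht.1, t, ht,
    fun j hj => Finset.mem_filter.2 ⟨Finset.mem_univ j, hj⟩,
    fun j hj => (Finset.mem_filter.1 hj).2.le⟩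

theorem exists_isHardThreshold (hγ₀ : 0 ≤ γ) (hγ₁ : γ ≤ 1) (A : Mat n₁ n₂) :
    ∃ G, IsHardThreshold γ A G := by
  choose T hT using fun i => exists_isTopFraction hγ₀ hγ₁ (fun j => A i j)
  choose T' hT' using fun j => exists_isTopFraction hγ₀ hγ₁ (fun i => A i j)
  exact ⟨fun i j => if j ∈ T i ∧ i ∈ T' j then 0 else A i j, T, T', hT, hT', fun _ _ => rfl⟩

theorem IsTopFraction.mul_sq_le_of_notMem {d s : Fin n → ℝ} {T : Finset (Fin n)}
    (hT : IsTopFraction γ (fun j => d j - s j) T)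
    (hs : ((Finset.univ.filter fun j => s j ≠ 0).card : ℝ) ≤ γs * n) {j : Fin n} (hj : j ∉ T) :
    (γ - γs) * n * (d j - s j) ^ 2 ≤ ∑ k, d k ^ 2 := by
  obtain ⟨-, t, ⟨-, ht⟩, hgt, -⟩ := hT
  have hjt : |d j - s j| ≤ t := not_lt.1 fun h => hj (hgt j h)
  set B := Finset.univ.filter fun k => t ≤ |d k - s k|
  set S := Finset.univ.filter fun k => s k ≠ 0
  have hcard : (γ - γs) * n ≤ ((B \ S).card : ℝ) := by
    have : (B.card : ℝ) ≤ (B \ S).card + S.card := by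
      exact_mod_cast Finset.card_le_card_sdiff_add_card
    linarith
  have hle : ∀ k ∈ B \ S, (d j - s j) ^ 2 ≤ d k ^ 2 := fun k hk => by
    obtain ⟨hkB, hkS⟩ := Finset.mem_sdiff.1 hk
    have hk0 : s k = 0 := by simpa [S] using hkS
    have hkt := (Finset.mem_filter.1 hkB).2
    rw [hk0, sub_zero] at hkt
    exact sq_le_sq.2 (hjt.trans hkt)
  calc (γ - γs) * n * (d j - s j) ^ 2 ≤ ((B \ S).card : ℝ) * (d j - s j) ^ 2 := by gcongr
    _ = ∑ k ∈ B \ S, (d j - s j) ^ 2 := by rw [Finset.sum_const, nsmul_eq_mul]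
    _ ≤ ∑ k ∈ B \ S, d k ^ 2 := Finset.sum_le_sum hle
    _ ≤ ∑ k, d k ^ 2 :=
      Finset.sum_le_sum_of_subset_of_nonneg (Finset.subset_univ _) fun _ _ _ => sq_nonneg _

theorem IsTopFraction.sq_le_of_notMem {d s : Fin n → ℝ} {T : Finset (Fin n)}
    (hT : IsTopFraction γ (fun j => d j - s j) T)
    (hs : ((Finset.univ.filter fun j => s j ≠ 0).card : ℝ) ≤ γs * n) (hγ : γs < γ) {j : Fin n}
    (hj : j ∉ T) : (d j - s j) ^ 2 ≤ (∑ k, d k ^ 2) / n / (γ - γs) := by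
  have hn : (0 : ℝ) < n := by exact_mod_cast j.pos
  rw [div_div, le_div_iff₀ (mul_pos hn (sub_pos.2 hγ))]
  linarith [hT.mul_sq_le_of_notMem hs hj]

theorem IsSparse.transpose {S : Mat n₁ n₂} (hS : IsSparse γs S) : IsSparse γs Sᵀ := hS.symm

theorem IsSparse.sum_ite_row_le {S : Mat n₁ n₂} (hS : IsSparse γs S) {ρ : Fin n₁ → ℝ}
    (hγs : 0 ≤ γs) (hρ : ∀ i, 0 ≤ ρ i) :
    ∑ i, ∑ j, (if S i j ≠ 0 then ρ i / n₂ else 0) ≤ γs * ∑ i, ρ i := by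
  rw [Finset.mul_sum]
  refine Finset.sum_le_sum fun i _ => ?_
  calc ∑ j, (if S i j ≠ 0 then ρ i / n₂ else 0)
      = (Finset.univ.filter fun j => S i j ≠ 0).card * (ρ i / n₂) := by
        rw [← Finset.sum_filter, Finset.sum_const, nsmul_eq_mul]
    _ ≤ γs * n₂ * (ρ i / n₂) :=
        mul_le_mul_of_nonneg_right (hS.1 i) (div_nonneg (hρ i) (Nat.cast_nonneg _))
    _ = γs * ρ i * (n₂ / n₂) := by ring
    _ ≤ γs * ρ i := mul_le_of_le_one_right (mul_nonneg hγs (hρ i)) (div_self_le_one _)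

theorem IsSparse.sum_ite_le {S : Mat n₁ n₂} (hS : IsSparse γs S) (hγs : 0 ≤ γs)
    (D : Mat n₁ n₂) :
    ∑ i, ∑ j, (if S i j ≠ 0 then (∑ k, D i k ^ 2) / n₂ + (∑ k, D k j ^ 2) / n₁ else 0) ≤
      2 * γs * ‖D‖ ^ 2 := by
  have hrow := hS.sum_ite_row_le hγs (ρ := fun i => ∑ k, D i k ^ 2) fun i => by positivity
  have hcol := hS.transpose.sum_ite_row_le hγs (ρ := fun j => ∑ k, D k j ^ 2) fun j => by
    positivity
  rw [Finset.sum_comm] at hcol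
  rw [← norm_sq_eq_sum] at hrow
  rw [Finset.sum_comm (f := fun j k => D k j ^ 2), ← norm_sq_eq_sum] at hcol
  calc _ = ∑ i, ∑ j, (if S i j ≠ 0 then (∑ k, D i k ^ 2) / n₂ else 0) +
        ∑ i, ∑ j, (if S i j ≠ 0 then (∑ k, D k j ^ 2) / n₁ else 0) := by
        simp only [← Finset.sum_add_distrib, ite_add_ite, add_zero]
    _ ≤ γs * ‖D‖ ^ 2 + γs * ‖D‖ ^ 2 := add_le_add hrow hcol
    _ = 2 * γs * ‖D‖ ^ 2 := by ring

/-- The weight with which `D i j ^ 2` enters the bound for the squared error at `(i, j)` of the hard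
thresholding of `D - S` that removes the entries in `T` and `T'`: an entry that is removed is
replaced by `0`, and an entry that is kept is wrong only if `S i j ≠ 0`. -/
noncomputable def thresholdWeight (T : Fin n₁ → Finset (Fin n₂)) (T' : Fin n₂ → Finset (Fin n₁))
    (S : Mat n₁ n₂) (i : Fin n₁) (j : Fin n₂) : ℝ :=
  if j ∈ T i ∧ i ∈ T' j then 1 else if S i j ≠ 0 then 2 else 0

section Weight

variable {T : Fin n₁ → Finset (Fin n₂)} {T' : Fin n₂ → Finset (Fin n₁)} {S : Mat n₁ n₂}

theorem thresholdWeight_nonneg (i : Fin n₁) (j : Fin n₂) : 0 ≤ thresholdWeight T T' S i j := by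
  unfold thresholdWeight; split_ifs <;> norm_num

theorem thresholdWeight_le_two (i : Fin n₁) (j : Fin n₂) : thresholdWeight T T' S i j ≤ 2 := by
  unfold thresholdWeight; split_ifs <;> norm_num

theorem thresholdWeight_transpose (i : Fin n₁) (j : Fin n₂) :
    thresholdWeight T' T Sᵀ j i = thresholdWeight T T' S i j :=
  if_congr and_comm rfl rfl

theorem sum_thresholdWeight_row_le (hS : IsSparse γs S) (hT : ∀ i, ((T i).card : ℝ) ≤ γ * n₂)
    (i : Fin n₁) : ∑ j, thresholdWeight T T' S i j ≤ (γ + 2 * γs) * n₂ := by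
  calc ∑ j, thresholdWeight T T' S i j
      ≤ ∑ j, ((if j ∈ T i then 1 else 0) + 2 * if S i j ≠ 0 then 1 else 0) := by
        refine Finset.sum_le_sum fun j _ => ?_
        rw [thresholdWeight]
        split_ifs <;> grind
    _ = (T i).card + 2 * (Finset.univ.filter fun j => S i j ≠ 0).card := by
        rw [Finset.sum_add_distrib, ← Finset.mul_sum, Finset.sum_boole, Finset.sum_boole,
          Finset.filter_univ_mem]
    _ ≤ (γ + 2 * γs) * n₂ := by linarith [hT i, hS.1 i]

theorem sum_thresholdWeight_col_le (hS : IsSparse γs S) (hT' : ∀ j, ((T' j).card : ℝ) ≤ γ * n₁)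
    (j : Fin n₂) : ∑ i, thresholdWeight T T' S i j ≤ (γ + 2 * γs) * n₁ := by
  simpa only [thresholdWeight_transpose] using
    sum_thresholdWeight_row_le (T' := T) hS.transpose hT' j

end Weight

theorem sq_sub_le_of_notMem_isTopFraction {D S : Mat n₁ n₂} {T : Fin n₁ → Finset (Fin n₂)}
    {T' : Fin n₂ → Finset (Fin n₁)} (hS : IsSparse γs S) (hγ : γs < γ)
    (hT : ∀ i, IsTopFraction γ (fun j => (D - S) i j) (T i))
    (hT' : ∀ j, IsTopFraction γ (fun i => (D - S) i j) (T' j)) {i : Fin n₁} {j : Fin n₂}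
    (hij : ¬(j ∈ T i ∧ i ∈ T' j)) :
    (D i j - S i j) ^ 2 ≤
      ((∑ k, D i k ^ 2) / n₂ + (∑ k, D k j ^ 2) / n₁) / (γ - γs) := by
  have : 0 < γ - γs := sub_pos.2 hγ
  rw [add_div]
  rcases not_and_or.1 hij with hj | hi
  · exact ((hT i).sq_le_of_notMem (hS.1 i) hγ hj).trans (le_add_of_nonneg_right (by positivity))
  · exact ((hT' j).sq_le_of_notMem (hS.2 j) hγ hi).trans (le_add_of_nonneg_left (by positivity))

theorem sq_ite_sub_le {p : Prop} [Decidable p] {d s x c : ℝ} (hx : 0 ≤ x) (hc : 0 < c)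
    (h : ¬p → (d - s) ^ 2 ≤ x / c) :
    ((if p then 0 else d - s) - d) ^ 2 ≤
      (if p then 1 else if s ≠ 0 then 2 else 0) * d ^ 2 + 2 / c * if s ≠ 0 then x else 0 := by
  by_cases hp : p
  · have : 0 ≤ if s ≠ 0 then x else 0 := by split_ifs <;> simp [hx]
    rw [if_pos hp, if_pos hp, zero_sub, neg_sq, one_mul]
    exact le_add_of_nonneg_right (by positivity)
  rw [if_neg hp, if_neg hp]
  by_cases hs : s = 0
  · simp [hs]
  rw [if_pos hs, if_pos hs]
  calc (d - s - d) ^ 2 ≤ 2 * d ^ 2 + 2 * (d - s) ^ 2 := by linarith [sq_nonneg (d - s + d)]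
    _ ≤ 2 * d ^ 2 + 2 * (x / c) := by gcongr; exact h hp
    _ = 2 * d ^ 2 + 2 / c * x := by ring

theorem IsHardThreshold.exists_norm_sub_sq_le {D S G : Mat n₁ n₂}
    (hG : IsHardThreshold γ (D - S) G) (hS : IsSparse γs S) (hγs : 0 ≤ γs) (hγ : γs < γ) :
    ∃ (T : Fin n₁ → Finset (Fin n₂)) (T' : Fin n₂ → Finset (Fin n₁)),
      (∀ i, ((T i).card : ℝ) ≤ γ * n₂) ∧ (∀ j, ((T' j).card : ℝ) ≤ γ * n₁) ∧
      ‖G - D‖ ^ 2 ≤ ∑ i, ∑ j, thresholdWeight T T' S i j * D i j ^ 2 +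
        4 * (γs / (γ - γs)) * ‖D‖ ^ 2 := by
  obtain ⟨T, T', hT, hT', hG⟩ := hG
  refine ⟨T, T', fun i => (hT i).1, fun j => (hT' j).1, ?_⟩
  have hgap := sub_pos.2 hγ
  set b : Fin n₁ → Fin n₂ → ℝ := fun i j => (∑ k, D i k ^ 2) / n₂ + (∑ k, D k j ^ 2) / n₁
  have hentry : ∀ i j, (G - D) i j ^ 2 ≤ thresholdWeight T T' S i j * D i j ^ 2 +
      2 / (γ - γs) * if S i j ≠ 0 then b i j else 0 := fun i j => by
    rw [Matrix.sub_apply, hG]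
    exact sq_ite_sub_le (by positivity) hgap
      fun hij => sq_sub_le_of_notMem_isTopFraction hS hγ hT hT' hij
  calc ‖G - D‖ ^ 2 ≤ ∑ i, ∑ j, (thresholdWeight T T' S i j * D i j ^ 2 +
        2 / (γ - γs) * if S i j ≠ 0 then b i j else 0) := by
        rw [norm_sq_eq_sum]
        exact Finset.sum_le_sum fun i _ => Finset.sum_le_sum fun j _ => hentry i j
    _ = ∑ i, ∑ j, thresholdWeight T T' S i j * D i j ^ 2 +
        2 / (γ - γs) * ∑ i, ∑ j, if S i j ≠ 0 then b i j else 0 := by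
        simp only [Finset.sum_add_distrib, Finset.mul_sum]
    _ ≤ ∑ i, ∑ j, thresholdWeight T T' S i j * D i j ^ 2 +
        2 / (γ - γs) * (2 * γs * ‖D‖ ^ 2) := by
        gcongr
        exact hS.sum_ite_le hγs D
    _ = ∑ i, ∑ j, thresholdWeight T T' S i j * D i j ^ 2 +
        4 * (γs / (γ - γs)) * ‖D‖ ^ 2 := by ring

end HardThreshold

/-! ### Incoherence -/

section Incoherence

section WeightedSum

variable {m n p : Type*} [Fintype m] [Fintype n] [Fintype p] {w : m → n → ℝ} {α α' β β' q : ℝ}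

theorem sum_mul_sq_mul_le (hw : ∀ i j, 0 ≤ w i j) (hcol : ∀ j, ∑ i, w i j ≤ β) (hα : 0 ≤ α)
    {U : Matrix m p ℝ} (hU : ∀ i, ∑ k, U i k ^ 2 ≤ α) (B : Matrix p n ℝ) :
    ∑ i, ∑ j, w i j * (U * B) i j ^ 2 ≤ β * α * ‖B‖ ^ 2 := by
  rw [Finset.sum_comm, norm_sq_eq_sum, Finset.sum_comm (f := fun k j => B k j ^ 2), Finset.mul_sum]
  refine Finset.sum_le_sum fun j _ => ?_
  have hentry : ∀ i, (U * B) i j ^ 2 ≤ α * ∑ k, B k j ^ 2 := fun i =>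
    calc (U * B) i j ^ 2 ≤ (∑ k, U i k ^ 2) * ∑ k, B k j ^ 2 :=
          Finset.sum_mul_sq_le_sq_mul_sq _ _ _
      _ ≤ α * ∑ k, B k j ^ 2 := by gcongr; exact hU i
  calc ∑ i, w i j * (U * B) i j ^ 2 ≤ ∑ i, w i j * (α * ∑ k, B k j ^ 2) :=
        Finset.sum_le_sum fun i _ => mul_le_mul_of_nonneg_left (hentry i) (hw i j)
    _ = (∑ i, w i j) * (α * ∑ k, B k j ^ 2) := by rw [Finset.sum_mul]
    _ ≤ β * (α * ∑ k, B k j ^ 2) := by gcongr; exact hcol j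
    _ = β * α * ∑ k, B k j ^ 2 := (mul_assoc _ _ _).symm

theorem sum_mul_sq_mul_transpose_le (hw : ∀ i j, 0 ≤ w i j) (hrow : ∀ i, ∑ j, w i j ≤ β)
    (hα : 0 ≤ α) {V : Matrix n p ℝ} (hV : ∀ j, ∑ k, V j k ^ 2 ≤ α) (B : Matrix m p ℝ) :
    ∑ i, ∑ j, w i j * (B * Vᵀ) i j ^ 2 ≤ β * α * ‖B‖ ^ 2 := by
  have h := sum_mul_sq_mul_le (w := fun j i => w i j) (fun j i => hw i j) hrow hα hV Bᵀ
  have hentry : ∀ i j, (V * Bᵀ) j i = (B * Vᵀ) i j := fun i j => by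
    rw [← transpose_apply (V * Bᵀ), transpose_mul, transpose_transpose]
  rw [Finset.sum_comm, frobenius_norm_transpose] at h
  simpa only [hentry] using h

/-- `D` splits into a matrix with incoherent column space, one with incoherent row space, and the
component normal to the tangent space; on the first two the weighted sum is small. -/
theorem sum_mul_sq_le [DecidableEq m] [DecidableEq n] [DecidableEq p] (hw : ∀ i j, 0 ≤ w i j)
    (hw₂ : ∀ i j, w i j ≤ 2) (hcol : ∀ j, ∑ i, w i j ≤ β) (hrow : ∀ i, ∑ j, w i j ≤ β')
    {U : Matrix m p ℝ} {V : Matrix n p ℝ} (hUo : Uᵀ * U = 1) (hVo : Vᵀ * V = 1)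
    (hα : 0 ≤ α) (hα' : 0 ≤ α') (hU : ∀ i, ∑ k, U i k ^ 2 ≤ α) (hV : ∀ j, ∑ k, V j k ^ 2 ≤ α')
    (hq : 0 ≤ q) (hβα : β * α ≤ q) (hβα' : β' * α' ≤ q) (D : Matrix m n ℝ) :
    ∑ i, ∑ j, w i j * D i j ^ 2 ≤
      4 * q * ‖D‖ ^ 2 + 4 * ‖perpProj U * D * perpProj V‖ ^ 2 := by
  set A := U * (Uᵀ * D) with hA
  set B := perpProj U * D * V * Vᵀ with hB
  set E := perpProj U * D * perpProj V with hE
  have hD : D = A + B + E := by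
    rw [add_assoc, hB, hE, mul_mul_transpose_add_mul_perpProj, hA,
      mul_transpose_mul_add_perpProj_mul]
  have hentry : ∀ i j, w i j * D i j ^ 2 ≤
      4 * (w i j * A i j ^ 2) + 4 * (w i j * B i j ^ 2) + 4 * E i j ^ 2 := fun i j => by
    have hsq : D i j ^ 2 ≤ 4 * A i j ^ 2 + 4 * B i j ^ 2 + 2 * E i j ^ 2 := by
      rw [hD, Matrix.add_apply, Matrix.add_apply]
      linarith [sq_nonneg (A i j + B i j - E i j), sq_nonneg (A i j - B i j)]
    linarith [mul_le_mul_of_nonneg_left hsq (hw i j),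
      mul_le_mul_of_nonneg_right (hw₂ i j) (sq_nonneg (E i j))]
  calc ∑ i, ∑ j, w i j * D i j ^ 2
      ≤ ∑ i, ∑ j, (4 * (w i j * A i j ^ 2) + 4 * (w i j * B i j ^ 2) + 4 * E i j ^ 2) :=
        Finset.sum_le_sum fun i _ => Finset.sum_le_sum fun j _ => hentry i j
    _ = 4 * ∑ i, ∑ j, w i j * A i j ^ 2 + 4 * ∑ i, ∑ j, w i j * B i j ^ 2 + 4 * ‖E‖ ^ 2 := by
        rw [norm_sq_eq_sum]
        simp only [Finset.mul_sum, Finset.sum_add_distrib]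
    _ ≤ 4 * (q * ‖Uᵀ * D‖ ^ 2) + 4 * (q * ‖perpProj U * D * V‖ ^ 2) + 4 * ‖E‖ ^ 2 := by
        gcongr
        · exact (sum_mul_sq_mul_le hw hcol hα hU _).trans (by gcongr)
        · exact (sum_mul_sq_mul_transpose_le hw hrow hα' hV _).trans (by gcongr)
    _ ≤ 4 * q * ‖D‖ ^ 2 + 4 * ‖E‖ ^ 2 := by
        rw [norm_sq_eq_add_perpProj_mul hUo D, norm_sq_eq_add_mul_perpProj hVo (perpProj U * D)]
        linarith [mul_nonneg hq (sq_nonneg ‖E‖)]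

end WeightedSum

variable {n n₁ n₂ r : ℕ} {γ γs μ c : ℝ}

theorem TwoInftyNormLE.sum_sq_le {U : Mat n r} (h : TwoInftyNormLE U c) (i : Fin n) :
    ∑ k, U i k ^ 2 ≤ c ^ 2 := by
  set u : EuclideanSpace ℝ (Fin r) := WithLp.toLp 2 (U i)
  have hu : ∑ k, U i k ^ 2 = ‖u‖ ^ 2 := (EuclideanSpace.real_norm_sq_eq u).symm
  rcases eq_or_ne u 0 with h0 | h0
  · rw [hu, h0, norm_zero, zero_pow two_ne_zero]
    positivity
  have hle := h (‖u‖⁻¹ • u) (norm_smul_inv_norm h0) i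
  have happly : (U *ᵥ (‖u‖⁻¹ • u).ofLp) i = ‖u‖ := by
    have hself : U i ⬝ᵥ U i = ‖u‖ ^ 2 := by
      rw [← hu]; exact Finset.sum_congr rfl fun k _ => (sq _).symm
    calc (U *ᵥ (‖u‖⁻¹ • u).ofLp) i = ‖u‖⁻¹ * (U i ⬝ᵥ U i) := dotProduct_smul _ _ _
      _ = ‖u‖ := by rw [hself, sq, inv_mul_cancel_left₀ (norm_ne_zero_iff.2 h0)]
  rw [happly, abs_norm] at hle
  rw [hu]
  gcongr

theorem norm_sq_of_orthonormal {U : Mat n r} (hU : Uᵀ * U = 1) : ‖U‖ ^ 2 = r := by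
  rw [← real_inner_self_eq_norm_sq, inner_eq_trace, hU, trace_one, Fintype.card_fin]

theorem one_le_of_twoInftyNormLE (hr : 1 ≤ r) {U : Mat n r} (hU : Uᵀ * U = 1)
    (h : TwoInftyNormLE U √(μ * r / n)) : 1 ≤ μ := by
  have hr' : (0 : ℝ) < r := by exact_mod_cast hr
  have hsum : (r : ℝ) ≤ n * √(μ * r / n) ^ 2 := by
    calc (r : ℝ) = ∑ i, ∑ k, U i k ^ 2 := by rw [← norm_sq_of_orthonormal hU, norm_sq_eq_sum]
      _ ≤ ∑ _i : Fin n, √(μ * r / n) ^ 2 := Finset.sum_le_sum fun i _ => h.sum_sq_le i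
      _ = n * √(μ * r / n) ^ 2 := by
        rw [Finset.sum_const, Finset.card_univ, Fintype.card_fin, nsmul_eq_mul]
  have hpos : 0 < √(μ * r / n) := by
    refine (Real.sqrt_nonneg _).lt_of_ne fun h0 => ?_
    rw [← h0] at hsum
    linarith
  have hn : (n : ℝ) ≠ 0 := fun h0 => by
    rw [h0, zero_mul] at hsum
    linarith
  rw [Real.sq_sqrt (Real.sqrt_pos.1 hpos).le, mul_div_cancel₀ _ hn] at hsum
  exact le_of_mul_le_mul_right (by linarith) hr'

theorem IsIncoherent.one_le {L : Mat n₁ n₂} (hL : IsIncoherent μ r L) (hr : 1 ≤ r) : 1 ≤ μ :=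
  let ⟨_, _, _, hsvd, hU, _⟩ := hL
  one_le_of_twoInftyNormLE hr hsvd.left_orthonormal hU

theorem IsSVD.isUnit_det {L : Mat n₁ n₂} {U : Mat n₁ r} {s : Fin r → ℝ} {V : Mat n₂ r}
    (h : IsSVD L U s V) : IsUnit (Uᵀ * L * V).det := by
  have hs : Uᵀ * L * V = diagonal s :=
    calc Uᵀ * L * V = (Uᵀ * U) * diagonal s * (Vᵀ * V) := by
          rw [h.eq]; simp only [Matrix.mul_assoc]
      _ = diagonal s := by
          rw [h.left_orthonormal, h.right_orthonormal, Matrix.one_mul, Matrix.mul_one]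
  rw [hs, det_diagonal, isUnit_iff_ne_zero]
  exact Finset.prod_ne_zero_iff.2 fun k _ => (h.pos k).ne'

theorem IsHardThreshold.norm_sub_sq_le {L D S G : Mat n₁ n₂} (hG : IsHardThreshold γ (D - S) G)
    (hS : IsSparse γs S) (hL : IsIncoherent μ r L) (hμ : 0 ≤ μ) (hγs : 0 ≤ γs) (hγ : γs < γ) :
    ‖G - D‖ ^ 2 ≤ (4 * (γ + 2 * γs) * μ * r + 4 * (γs / (γ - γs))) * ‖D‖ ^ 2 +
      4 * ‖(tangentSubmodule L)ᗮ.starProjection D‖ ^ 2 := by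
  obtain ⟨T, T', hT, hT', hGD⟩ := hG.exists_norm_sub_sq_le hS hγs hγ
  obtain ⟨U, s, V, hsvd, hU, hV⟩ := hL
  have hdensity : 0 ≤ (γ + 2 * γs) * μ * r :=
    mul_nonneg (mul_nonneg (by linarith) hμ) (Nat.cast_nonneg r)
  have hcancel : ∀ n : ℕ, (γ + 2 * γs) * n * √(μ * r / n) ^ 2 ≤ (γ + 2 * γs) * μ * r :=
    fun n => by
      rw [Real.sq_sqrt (by positivity)]
      calc (γ + 2 * γs) * n * (μ * r / n) = (γ + 2 * γs) * μ * r * (n / n) := by ring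
        _ ≤ (γ + 2 * γs) * μ * r := mul_le_of_le_one_right hdensity (div_self_le_one _)
  have hweight := sum_mul_sq_le thresholdWeight_nonneg thresholdWeight_le_two
    (sum_thresholdWeight_col_le hS hT') (sum_thresholdWeight_row_le hS hT)
    hsvd.left_orthonormal hsvd.right_orthonormal (sq_nonneg _) (sq_nonneg _) hU.sum_sq_le
    hV.sum_sq_le hdensity (hcancel n₁) (hcancel n₂) D
  rw [hsvd.isOrthonormalFrame.starProjection_orthogonal hsvd.isUnit_det]
  linarith

/-- The radius `a * σ_r(L)` of the ball enters through the second order tangency of the manifold to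
the tangent space at `L`. -/
theorem IsHardThreshold.norm_sub_le {L X S G : Mat n₁ n₂} {a : ℝ}
    (hG : IsHardThreshold γ (X - (L + S)) G) (hS : IsSparse γs S) (hL : IsIncoherent μ r L)
    (hμ : 0 ≤ μ) (hγs : 0 ≤ γs) (hγ : γs < γ) (hLr : L.rank = r) (hX : X.rank = r)
    (hXL : ‖X - L‖ ≤ a * singularValue r L) (hlt : ‖X - L‖ < singularValue r L) :
    ‖G - (X - L)‖ ≤
      √(4 * (γ + 2 * γs) * μ * r + 4 * (γs / (γ - γs)) + a ^ 2) * ‖X - L‖ := by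
  set E := (tangentSubmodule L)ᗮ.starProjection (X - L)
  have hE : 2 * ‖E‖ ≤ a * ‖X - L‖ := by
    refine le_of_mul_le_mul_left ?_ ((norm_nonneg _).trans_lt hlt)
    calc singularValue r L * (2 * ‖E‖) = 2 * singularValue r L * ‖E‖ := by ring
      _ ≤ ‖X - L‖ * ‖X - L‖ := by
        rw [← sq]; exact two_mul_norm_starProjection_orthogonal_le hLr hX hlt
      _ ≤ a * singularValue r L * ‖X - L‖ := by gcongr
      _ = singularValue r L * (a * ‖X - L‖) := by ring
  rw [← sub_sub] at hG
  have hsq := hG.norm_sub_sq_le hS hL hμ hγs hγ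
  have hE2 : (2 * ‖E‖) ^ 2 ≤ (a * ‖X - L‖) ^ 2 := by gcongr
  rw [← Real.sqrt_sq (norm_nonneg (X - L)), ← Real.sqrt_mul' _ (sq_nonneg _)]
  refine Real.le_sqrt_of_sq_le ?_
  linarith

end Incoherence

/-! ### The projected gradient step -/

section ProjectedGradient

variable {E : Type*} [NormedAddCommGroup E] [InnerProductSpace ℝ E] {D G P : E} {c p C η : ℝ}

section

variable {K : Submodule ℝ E} [K.HasOrthogonalProjection]

theorem le_inner_starProjection (hD : ‖Kᗮ.starProjection D‖ ≤ ‖D‖ / 2)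
    (hG : ‖G - D‖ ≤ C * ‖D‖) (hC : C ≤ 1 / 2) :
    (1 - 2 * C) / 4 * ‖D‖ ^ 2 ≤ ⟪K.starProjection G, D⟫_ℝ := by
  set Q := K.starProjection D with hQ
  have hQ_ge : ‖D‖ / 2 ≤ ‖Q‖ := by
    have hsub := norm_sub_norm_le D Q
    rw [hQ, ← Submodule.starProjection_orthogonal_val] at hsub
    linarith
  have hinner : ⟪K.starProjection G, D⟫_ℝ = ‖Q‖ ^ 2 + ⟪G - D, Q⟫_ℝ := by
    have hself : ⟪D, Q⟫_ℝ = ‖Q‖ ^ 2 := by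
      rw [← real_inner_self_eq_norm_sq, hQ, K.inner_starProjection_left_eq_right,
        Submodule.starProjection_eq_self_iff.2 (K.starProjection_apply_mem D)]
    rw [K.inner_starProjection_left_eq_right, inner_sub_left, hself, add_sub_cancel]
  have herror : -(C * ‖D‖ * ‖Q‖) ≤ ⟪G - D, Q⟫_ℝ :=
    calc -(C * ‖D‖ * ‖Q‖) ≤ -(‖G - D‖ * ‖Q‖) := by gcongr
      _ ≤ ⟪G - D, Q⟫_ℝ := neg_le_of_abs_le (abs_real_inner_le_norm _ _)
  calc (1 - 2 * C) / 4 * ‖D‖ ^ 2 = ‖D‖ / 2 * (‖D‖ / 2 - C * ‖D‖) := by ring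
    _ ≤ ‖Q‖ * (‖Q‖ - C * ‖D‖) := by
      refine mul_le_mul hQ_ge (by linarith) ?_ (norm_nonneg Q)
      linarith [mul_le_mul_of_nonneg_right hC (norm_nonneg D)]
    _ = ‖Q‖ ^ 2 + -(C * ‖D‖ * ‖Q‖) := by ring
    _ ≤ ⟪K.starProjection G, D⟫_ℝ := by rw [hinner]; gcongr

theorem norm_starProjection_le_of_norm_sub_le (hG : ‖G - D‖ ≤ C * ‖D‖) :
    ‖K.starProjection G‖ ≤ (1 + C) * ‖D‖ :=
  calc ‖K.starProjection G‖ ≤ ‖G‖ := K.norm_starProjection_apply_le G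
    _ ≤ ‖D‖ + ‖G - D‖ := by simpa only [add_sub_cancel] using norm_add_le D (G - D)
    _ ≤ (1 + C) * ‖D‖ := by linarith

end

theorem norm_sub_smul_le (hc : c * ‖D‖ ^ 2 ≤ ⟪P, D⟫_ℝ) (hp : ‖P‖ ≤ p * ‖D‖) (hη : 0 ≤ η) :
    ‖D - η • P‖ ≤ (1 - c * η + p ^ 2 / 2 * η ^ 2) * ‖D‖ := by
  rcases (norm_nonneg D).eq_or_lt with h0 | hpos
  · have hP : P = 0 := norm_le_zero_iff.1 (by rwa [← h0, mul_zero] at hp)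
    rw [hP, smul_zero, sub_zero, ← h0, mul_zero]
  have hsq : ‖D - η • P‖ ^ 2 = ‖D‖ ^ 2 - 2 * (η * ⟪P, D⟫_ℝ) + η ^ 2 * ‖P‖ ^ 2 := by
    rw [norm_sub_sq_real, real_inner_smul_right, real_inner_comm, norm_smul, mul_pow,
      Real.norm_eq_abs, sq_abs]
  have hp2 : η ^ 2 * ‖P‖ ^ 2 ≤ η ^ 2 * (p * ‖D‖) ^ 2 := by gcongr
  refine le_of_mul_le_mul_right ?_ hpos
  calc ‖D - η • P‖ * ‖D‖ ≤ (‖D - η • P‖ ^ 2 + ‖D‖ ^ 2) / 2 := by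
        linarith [two_mul_le_add_sq ‖D - η • P‖ ‖D‖]
    _ ≤ (1 - c * η + p ^ 2 / 2 * η ^ 2) * ‖D‖ * ‖D‖ := by
      linarith [mul_le_mul_of_nonneg_left hc hη]

end ProjectedGradient

/-! ### Gradient descent -/

section Descent

variable {n₁ n₂ r : ℕ} {C η ρ : ℝ} {X L G P : Mat n₁ n₂}
  {R : Mat n₁ n₂ → Mat n₁ n₂ → Mat n₁ n₂ → Prop}

theorem exists_isOrthographicAdmissible_norm_sub_le {d : ℝ} (hX : X.rank = r)
    (hd : d < singularValue r X) (hP : P ∈ tangentSubmodule X) (hPd : ‖P‖ ≤ 3 / 2 * d)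
    (hη₀ : 0 ≤ η) (hη : η ≤ 1 / 6) :
    ∃ Z, IsOrthographicAdmissible r X (-(η • P)) Z ∧ ‖X + -(η • P) - Z‖ ≤ 3 * η ^ 2 * d := by
  have hd₀ : 0 ≤ d := by linarith [norm_nonneg P]
  have hσ : 0 < singularValue r X := hd₀.trans_lt hd
  have hδ : ‖-(η • P)‖ ≤ 3 / 2 * η * d := by
    rw [norm_neg, norm_smul, Real.norm_of_nonneg hη₀]
    linarith [mul_le_mul_of_nonneg_left hPd hη₀]
  have hδσ : ‖-(η • P)‖ ≤ singularValue r X / 4 := by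
    linarith [mul_le_mul_of_nonneg_right hη hd₀]
  obtain ⟨Z, hZ, hle⟩ := exists_isOrthographicAdmissible hX
    (neg_mem (Submodule.smul_mem _ η hP)) (by linarith)
  refine ⟨Z, hZ, le_of_mul_le_mul_left ?_ (show 0 < 3 / 4 * singularValue r X by positivity)⟩
  calc 3 / 4 * singularValue r X * ‖X + -(η • P) - Z‖
      ≤ (singularValue r X - ‖-(η • P)‖) * ‖X + -(η • P) - Z‖ := by gcongr; linarith
    _ ≤ ‖-(η • P)‖ ^ 2 := hle
    _ ≤ (3 / 2 * η * d) ^ 2 := by gcongr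
    _ = 9 / 4 * η ^ 2 * d * d := by ring
    _ ≤ 9 / 4 * η ^ 2 * d * singularValue r X := by gcongr
    _ = 3 / 4 * singularValue r X * (3 * η ^ 2 * d) := by ring

/-- The matrices of rank `r` in the ball of radius `ρ` around `L`: for small `ρ`, the set on which
gradient descent contracts the distance to `L`. -/
def basin (r : ℕ) (ρ : ℝ) (L : Mat n₁ n₂) : Set (Mat n₁ n₂) :=
  {X | X.rank = r ∧ ‖X - L‖ ≤ ρ}

/-- The gradient step gains `(1 - 2C)/4 * η` to first order; the second order losses of the step
and of the retraction add up to `(9/8 + 3) * η²`, at most half the gain. -/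
theorem exists_isOrthographicAdmissible_forall_norm_sub_le (hL : L.rank = r)
    (hρ : 2 * ρ < singularValue r L) (hX : X ∈ basin r ρ L) (hG : ‖G - (X - L)‖ ≤ C * ‖X - L‖)
    (hC : 0 ≤ C) (hη₀ : 0 < η) (hη : η ≤ (1 - 2 * C) / 40)
    (hP : (tangentSubmodule X).starProjection G = P) :
    ∃ Z₀, IsOrthographicAdmissible r X (-(η • P)) Z₀ ∧
      ∀ Z, ‖X + -(η • P) - Z‖ ≤ ‖X + -(η • P) - Z₀‖ →
        ‖Z - L‖ ≤ (1 - (1 - 2 * C) / 8 * η) * ‖X - L‖ := by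
  have hσ : ‖X - L‖ < singularValue r X := by
    have hweyl := singularValue_le_add_norm_sub r L X
    rw [norm_sub_rev] at hweyl
    linarith [hX.2]
  have hnormal : ‖(tangentSubmodule X)ᗮ.starProjection (X - L)‖ ≤ ‖X - L‖ / 2 := by
    have htangency := two_mul_norm_starProjection_orthogonal_le hX.1 hL
      (by rwa [norm_sub_rev])
    rw [← neg_sub X L, map_neg, norm_neg, norm_neg] at htangency
    refine le_of_mul_le_mul_left ?_ ((norm_nonneg _).trans_lt hσ)
    nlinarith [mul_le_mul_of_nonneg_right hσ.le (norm_nonneg (X - L))]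
  have hPmem : P ∈ tangentSubmodule X := hP ▸ Submodule.starProjection_apply_mem _ G
  have hPnorm : ‖P‖ ≤ 3 / 2 * ‖X - L‖ := by
    refine (hP ▸ norm_starProjection_le_of_norm_sub_le hG).trans ?_
    gcongr
    linarith
  have hstep := norm_sub_smul_le (hP ▸ le_inner_starProjection hnormal hG (by linarith))
    hPnorm hη₀.le
  obtain ⟨Z₀, hZ₀, hclose⟩ := exists_isOrthographicAdmissible_norm_sub_le hX.1 hσ hPmem hPnorm
    hη₀.le (by linarith)
  refine ⟨Z₀, hZ₀, fun Z hZ => ?_⟩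
  have hsecond : 33 / 8 * η ^ 2 ≤ (1 - 2 * C) / 8 * η := by
    linarith [mul_le_mul_of_nonneg_right hη hη₀.le, mul_pos hη₀ hη₀]
  calc ‖Z - L‖ = ‖(X - L - η • P) - (X + -(η • P) - Z)‖ := by congr 1; abel
    _ ≤ ‖X - L - η • P‖ + ‖X + -(η • P) - Z‖ := norm_sub_le _ _
    _ ≤ (1 - (1 - 2 * C) / 8 * η) * ‖X - L‖ := by
      linarith [mul_le_mul_of_nonneg_right hsecond (norm_nonneg (X - L))]

theorem IsUpdate.mem_basin_and_norm_sub_le (hR : IsMinimizingRetraction r R) (hL : L.rank = r)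
    (hρ : 2 * ρ < singularValue r L) (hX : X ∈ basin r ρ L) (hG : ‖G - (X - L)‖ ≤ C * ‖X - L‖)
    (hC : 0 ≤ C) (hη₀ : 0 < η) (hη : η ≤ (1 - 2 * C) / 40) {X' : Mat n₁ n₂}
    (h : IsUpdate R η X G X') :
    X' ∈ basin r ρ L ∧ ‖X' - L‖ ≤ (1 - (1 - 2 * C) / 8 * η) * ‖X - L‖ := by
  obtain ⟨P, hP, hX'⟩ := h
  obtain ⟨Z₀, hZ₀, hcontract⟩ := exists_isOrthographicAdmissible_forall_norm_sub_le hL hρ hX hG hC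
    hη₀ hη (isTangentProjection_iff.1 hP)
  have hle := hcontract X' (hR.norm_sub_le hX' hZ₀)
  have hfactor : 1 - (1 - 2 * C) / 8 * η ≤ 1 := by nlinarith
  exact ⟨⟨hR.rank_eq hX', hle.trans ((mul_le_of_le_one_left (norm_nonneg _) hfactor).trans hX.2)⟩,
    hle⟩

theorem exists_isUpdate (hR : IsMinimizingRetraction r R) (hL : L.rank = r)
    (hρ : 2 * ρ < singularValue r L) (hX : X ∈ basin r ρ L) (hG : ‖G - (X - L)‖ ≤ C * ‖X - L‖)
    (hC : 0 ≤ C) (hη₀ : 0 < η) (hη : η ≤ (1 - 2 * C) / 40) :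
    ∃ X', IsUpdate R η X G X' := by
  obtain ⟨Z₀, hZ₀, hcontract⟩ := exists_isOrthographicAdmissible_forall_norm_sub_le hL hρ hX hG hC
    hη₀ hη rfl
  have hfactor : 1 - (1 - 2 * C) / 8 * η ≤ 1 := by nlinarith
  obtain ⟨X', hX'⟩ := hR.exists_of_forall_le_rank hZ₀ fun Z hZ => by
    refine le_rank_of_norm_sub_lt (X := L) ?_
    rw [norm_sub_rev]
    linarith [hcontract Z hZ, mul_le_of_le_one_left (norm_nonneg (X - L)) hfactor, hX.2,
      norm_nonneg (X - L)]
  exact ⟨X', _, isTangentProjection_iff.2 rfl, hX'⟩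

theorem mem_and_le_pow_mul_of_forall_lt {α : Type*} {f : α → ℝ} {s : Set α} {S : α → α → Prop}
    {q : ℝ} (hq : 0 ≤ q) (hS : ∀ ⦃x y⦄, x ∈ s → S x y → y ∈ s ∧ f y ≤ q * f x) {u : ℕ → α}
    (hu₀ : u 0 ∈ s) {k : ℕ} (hu : ∀ i < k, S (u i) (u (i + 1))) :
    u k ∈ s ∧ f (u k) ≤ q ^ k * f (u 0) := by
  induction k with
  | zero => exact ⟨hu₀, by rw [pow_zero, one_mul]⟩
  | succ k ih =>
    obtain ⟨hmem, hle⟩ := ih fun i hi => hu i (hi.trans k.lt_succ_self)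
    obtain ⟨hmem', hle'⟩ := hS hmem (hu k k.lt_succ_self)
    refine ⟨hmem', hle'.trans ?_⟩
    rw [pow_succ', mul_assoc]
    gcongr

end Descent

theorem IsIncoherent.lt_half_and_le_one {n₁ n₂ r : ℕ} {L : Mat n₁ n₂} {γ γs μ a : ℝ}
    (hL : IsIncoherent μ r L) (hr : 1 ≤ r) (hγs : 0 ≤ γs) (hγ : γs < γ)
    (hC : √(4 * (γ + 2 * γs) * μ * r + 4 * (γs / (γ - γs)) + a ^ 2) < 1 / 2) :
    a < 1 / 2 ∧ γ ≤ 1 := by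
  have hμr : 1 ≤ μ * r := one_le_mul_of_one_le_of_one_le (hL.one_le hr) (by exact_mod_cast hr)
  have hfrac : 0 ≤ γs / (γ - γs) := div_nonneg hγs (by linarith)
  have hγμ : 4 * γ * 1 ≤ 4 * (γ + 2 * γs) * (μ * r) := by gcongr <;> linarith
  have hsq := (Real.sqrt_lt' one_half_pos).1 hC
  exact ⟨lt_of_pow_lt_pow_left₀ 2 one_half_pos.le (by linarith), by linarith [sq_nonneg a]⟩

end RobustPCA

theorem theorem1 {n₁ n₂ r : ℕ} (hr : 1 ≤ r)
    (Y Ls Ss L₀ : RobustPCA.Mat n₁ n₂) (hY : Y = Ls + Ss)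
    (γs γ μ a C₁ : ℝ) (hγs₀ : 0 ≤ γs) (hγs₁ : γs < 1)
    (hS : RobustPCA.IsSparse γs Ss)
    (hrank : Ls.rank = r) (hL : RobustPCA.IsIncoherent μ r Ls)
    (hL₀ : L₀.rank = r) (hinit : ‖L₀ - Ls‖ ≤ a * RobustPCA.singularValue r Ls)
    (ha : a ≤ 1 / 2) (hγ : 2 * γs < γ)
    (hC₁ : C₁ = Real.sqrt (4 * (γ + 2 * γs) * μ * r + 4 * (γs / (γ - γs)) + a ^ 2))
    (hC₁_lt : C₁ < 1 / 2) :
    ∃ η₀ : ℝ, 0 < η₀ ∧ ∀ η : ℝ, 0 < η → η < η₀ →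
      ∀ R : RobustPCA.Mat n₁ n₂ → RobustPCA.Mat n₁ n₂ → RobustPCA.Mat n₁ n₂ → Prop,
        R = RobustPCA.IsProjectiveRetraction r ∨ R = RobustPCA.IsOrthographicRetraction r →
        ∀ L : ℕ → RobustPCA.Mat n₁ n₂, L 0 = L₀ →
          ∀ k : ℕ, (∀ i < k, RobustPCA.IsStep R γ η Y (L i) (L (i + 1))) →
            ‖L k - Ls‖ ≤ (1 - (1 - 2 * C₁) / 8 * η) ^ k * ‖L₀ - Ls‖ ∧
              RobustPCA.CanContinue R γ η Y (L k) := by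
  subst hY
  have hσ := (RobustPCA.singularValue_pos_iff hr).2 hrank.ge
  have hC₀ : 0 ≤ C₁ := hC₁ ▸ Real.sqrt_nonneg _
  obtain ⟨ha_lt, hγ₁⟩ := hL.lt_half_and_le_one hr hγs₀ (by linarith) (hC₁ ▸ hC₁_lt)
  set ρ := a * RobustPCA.singularValue r Ls
  have hρ : 2 * ρ < RobustPCA.singularValue r Ls := by
    linarith [mul_lt_mul_of_pos_right ha_lt hσ]
  have hgrad : ∀ X ∈ RobustPCA.basin r ρ Ls, ∀ G,
      RobustPCA.IsHardThreshold γ (X - (Ls + Ss)) G → ‖G - (X - Ls)‖ ≤ C₁ * ‖X - Ls‖ :=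
    fun X hX G hG => hC₁ ▸ hG.norm_sub_le hS hL (zero_le_one.trans (hL.one_le hr)) hγs₀
      (by linarith) hrank hX.1 hX.2 (by linarith [hX.2, norm_nonneg (X - Ls)])
  refine ⟨(1 - 2 * C₁) / 40, by linarith, fun η hη₀ hη R hR L hL0 k hstep => ?_⟩
  have hR' := RobustPCA.isMinimizingRetraction_of_eq_or_eq hR
  have hq : 0 ≤ 1 - (1 - 2 * C₁) / 8 * η := by nlinarith
  obtain ⟨hmem, hle⟩ := RobustPCA.mem_and_le_pow_mul_of_forall_lt hq (f := fun X => ‖X - Ls‖)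
    (fun X X' hX ⟨G, hG, hX'⟩ =>
      hX'.mem_basin_and_norm_sub_le hR' hrank hρ hX (hgrad X hX G hG) hC₀ hη₀ hη.le)
    (hL0 ▸ ⟨hL₀, hinit⟩) hstep
  exact ⟨hL0 ▸ hle, RobustPCA.exists_isHardThreshold (by linarith) hγ₁ _, fun G hG =>
    RobustPCA.exists_isUpdate hR' hrank hρ hmem (hgrad _ hmem G hG) hC₀ hη₀ hη.le⟩
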